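/- Let $\beta>1$ be a Pisot number, i.e. a real algebraic integer all of whose other conjugates have modulus $<1$. Let $T(x)=\beta x-\lfloor\beta x\rfloor$; the $\beta$-expansion $d_\beta(x)=u_1u_2\cdots$ of $x\in[0,1]$ has digits $u_i=\lfloor\beta T^{i-1}(x)\rfloor$. Let $\Pi_\beta$ be the set of $x\in[0,1)$ with purely periodic $\beta$-expansion. Let $N(\beta)$ be the norm of $\beta$ from $\mathbb Q(\beta)$ to $\mathbb Q$, let $\mathbb Z_{(N(\beta))}=\{p/q:\ p,q\in\mathbb Z,\ q\neq 0,\ \gcd(q,N(\beta))=1\}$, and $$\gamma(\beta)=\sup\{v\in[0,1]:\ \text{every } x\in\mathbb Z_{(N(\beta))}\text{ with }0<x\le v\text{ lies in }\Pi_\beta\}.$$ Put $d^*_\beta(1)=d_\beta(1)$ if $d_\beta(1)$ is infinite, and $d^*_\beta(1)=(u_1\cdots u_{N-1}(u_N-1))^\infty$ if $d_\beta(1)=u_1\cdots u_N0^\infty$ with $u_N\ne0$. Write $d_\beta^*(1)=t_1\cdots t_m(t_{m+1}\cdots t_n)^\infty$ with $m$ the minimal preperiod length and $n-m$ the minimal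 period length. A finite string $w$ of digits in $\{0,\dots,\lceil\beta\rceil-1\}$ is admissible if every shift of $w0^\infty$ is lexicographically smaller than $d_\beta^*(1)$. The admissibility graph has nodes $1,\dots,n$; from each node $b$ there are $t_b$ edges to node $1$, labelled $0,\dots,t_b-1$, and one edge labelled $t_b$, which goes to $b+1$ if $b<n$ and to $m+1$ if $b=n$. Let $\mathcal L^{(a)}$ be the set of admissible strings which this graph conducts from node $1$ to node $a$. Let $\mathbb K_\infty\simeq\mathbb R^{r-1}\times\mathbb C^s$ be the product of the Archimedean completions of $\mathbb Q(\beta)$ other than the one given by the inclusion in $\mathbb R$, let $\mathbb K_f$ be the product of the completions of $\mathbb Q(\beta)$ at the prime ideals of its ring of integers that contain $\beta$, and let $\phi_\infty$, $\phi_f$ and $\phi_\beta=(\phi_\infty,\phi_f)$ be the natural embeddings of $\mathbb Q(\beta)$ in $\mathbb K_\infty$, $\mathbb K_f$ and $\mathbb K_\infty\times\mathbb K_f$. For $A\subset\mathbb R$ let $\Delta_\infty(A)=\{(x,\dots,x):x\in A\}\subset\mathbb K_\infty$. Let $\widetilde{\mathcal T}$ (resp. $\widetilde{\mathcal T}^{(a)}$,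 $1\le a\le n$) be the closure of the set of all $\phi_\beta(w_p\beta^p+\cdots+w_0)$ with $w_p\cdots w_0$ admissible (resp. $w_p\cdots w_0\in\mathcal L^{(a)}$). Put $F=\overline{\phi_f(\mathbb Z_{(N(\beta))})}$. The numbers $T^{a-1}(1)$, $1\le a\le n$, are pairwise distinct, so $\{1,\dots,n\}=\{a_1,\dots,a_n\}$ with $\theta_k:=T^{a_k-1}(1)$ strictly increasing in $k$; put $\theta_0:=0$. Then, for $1\le k\le n$: 1. $\gamma(\beta)\ge\theta_k$ if and only if $$\gamma(\beta)\ge\theta_{k-1}\quad\text{and}\quad\Delta_\infty([\theta_{k-1},\theta_k])\times F\subset\bigcup_{j=k}^n(-\widetilde{\mathcal T}^{(a_j)}).$$ 2. If $\theta_{k-1}<\gamma(\beta)\le\theta_k$, then $$\gamma(\beta)=\sup\Big\{\eta\in[\theta_{k-1},\theta_k]:\ \Delta_\infty([\theta_{k-1},\eta])\times F\subset\bigcup_{j=k}^n(-\widetilde{\mathcal T}^{(a_j)})\Big\};$$ if moreover $\gamma(\beta)<\theta_k$, the restriction $\eta\le\theta_k$ may be omitted. Finally, if $-\widetilde{\mathcal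 T}$ does not contain $\Delta_\infty([0,\eta])\times F$ for any $\eta>0$, then $\gamma(\beta)=0$. -/

import Mathlib

open scoped NumberField Pointwise

namespace PisotBeta

/-! ### Pisot numbers, the beta-transformation and beta-expansions -/

/-- A Pisot number: a real algebraic integer `β > 1` all of whose other conjugates lie in the open
unit disc. -/
structure IsPisot (β : ℝ) : Prop where
  isIntegral : IsIntegral ℤ β
  one_lt : 1 < β
  norm_conj_lt_one : ∀ z : ℂ, Polynomial.aeval z (minpoly ℚ β) = 0 → z ≠ (β : ℂ) → ‖z‖ < 1

/-- The beta-transformation `x ↦ β x mod 1`. -/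
noncomputable def T (β x : ℝ) : ℝ := Int.fract (β * x)

/-- The digits of the beta-expansion of `x`, numbered from `0`:
`digit β x i` is the usual `u_{i+1} = ⌊β T^i x⌋`. -/
noncomputable def digit (β x : ℝ) (i : ℕ) : ℕ := ⌊β * (T β)^[i] x⌋₊

/-- The reals in `[0,1)` with purely periodic beta-expansion. -/
def purelyPeriodic (β : ℝ) : Set ℝ :=
  {x | x ∈ Set.Ico (0 : ℝ) 1 ∧ ∃ l : ℕ, 0 < l ∧ ∀ i, digit β x (i + l) = digit β x i}

open Classical in
/-- The sequence `d*_β(1) = t_1 t_2 …`, with `dstar β i = t_{i+1}`. It is the expansion `d_β(1)` if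
that is infinite, and `(u_1 … u_{N-1} (u_N - 1))^∞` if `d_β(1) = u_1 … u_N 0^∞` with `u_N ≠ 0`
(the least index from which all digits vanish is `N`). -/
noncomputable def dstar (β : ℝ) (i : ℕ) : ℕ :=
  if h : ∃ N, ∀ j, N ≤ j → digit β 1 j = 0 then
    if i % Nat.find h = Nat.find h - 1 then digit β 1 (i % Nat.find h) - 1
    else digit β 1 (i % Nat.find h)
  else digit β 1 i

/-- The length `m` of the preperiod of `d*_β(1)`. -/
noncomputable def preperiod (β : ℝ) : ℕ :=
  sInf {m | ∃ p, 0 < p ∧ ∀ i, m ≤ i → dstar β (i + p) = dstar β i}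

/-- The length of the (least) period of `d*_β(1)`. -/
noncomputable def period (β : ℝ) : ℕ :=
  sInf {p | 0 < p ∧ ∀ i, preperiod β ≤ i → dstar β (i + p) = dstar β i}

/-- `n`, the sum of the lengths of the preperiod and of the period of `d*_β(1)`. The alphabet of
nodes is `{1, …, n}`. -/
noncomputable def size (β : ℝ) : ℕ := preperiod β + period β

/-- Strict lexicographic order on digit sequences. -/
def LexLT (u v : ℕ → ℕ) : Prop := ∃ k, (∀ i, i < k → u i = v i) ∧ u k < v k

/-- Admissible finite strings `w` (most significant digit first): the digits are in
`{0, …, ⌈β⌉ - 1}` and every shift of `w 0^∞` is lexicographically smaller than `d*_β(1)`. -/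
def Admissible (β : ℝ) (w : List ℕ) : Prop :=
  (∀ d ∈ w, d < ⌈β⌉₊) ∧ ∀ k : ℕ, LexLT (fun i => w.getD (k + i) 0) (dstar β)

/-- `Edge β b ε a`: the admissibility graph has an edge `b → a` labelled `ε`. From each node `b`
there are edges to `1` labelled `0, …, t_b - 1`, and one edge labelled `t_b`, to `b + 1` if `b < n`
and to `m + 1` if `b = n`. -/
def Edge (β : ℝ) (b ε a : ℕ) : Prop :=
  b ∈ Set.Icc 1 (size β) ∧
    ((ε < dstar β (b - 1) ∧ a = 1) ∨
     (ε = dstar β (b - 1) ∧ b < size β ∧ a = b + 1) ∨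
     (ε = dstar β (b - 1) ∧ b = size β ∧ a = preperiod β + 1))

/-- `Leads β b w a`: reading the string `w` in the admissibility graph from `b` ends at `a`. -/
inductive Leads (β : ℝ) : ℕ → List ℕ → ℕ → Prop
  | nil (a : ℕ) : Leads β a [] a
  | cons {b c a ε : ℕ} {w : List ℕ} (h : Edge β b ε c) (h' : Leads β c w a) :
      Leads β b (ε :: w) a

/-- The admissible strings which the admissibility graph conducts from the node `1` to `a`. -/
def language (β : ℝ) (a : ℕ) : Set (List ℕ) := {w | Admissible β w ∧ Leads β 1 w a}

/-- `a_1, …, a_n` is the relabelling of the nodes `1, …, n` for which the numbers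
`T^{a_k - 1}(1)` are strictly increasing in `k`. -/
structure IsOrbitOrdering (β : ℝ) (a : ℕ → ℕ) : Prop where
  bijOn : Set.BijOn a (Set.Icc 1 (size β)) (Set.Icc 1 (size β))
  strictMonoOn : StrictMonoOn (fun k => (T β)^[a k - 1] 1) (Set.Icc 1 (size β))

/-- The number `T^{a_k - 1}(1)`, which is `0` for `k = 0` by convention. -/
noncomputable def level (β : ℝ) (a : ℕ → ℕ) (k : ℕ) : ℝ :=
  if k = 0 then 0 else (T β)^[a k - 1] 1

/-! ### The field `ℚ(β)` and the complete representation space -/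

/-- The field `ℚ(β)`, as a subfield of `ℝ`. -/
abbrev BetaField (β : ℝ) : Type := IntermediateField.adjoin ℚ ({β} : Set ℝ)

/-- `β` as an element of `ℚ(β)`. -/
noncomputable def gen (β : ℝ) : BetaField β := IntermediateField.AdjoinSimple.gen ℚ β

instance (β : ℝ) [hβ : Fact (IsPisot β)] : NumberField (BetaField β) where
  to_charZero := inferInstance
  to_finiteDimensional :=
    IntermediateField.adjoin.finiteDimensional (hβ.out.isIntegral.tower_top (A := ℚ))

theorem isIntegral_gen (β : ℝ) [hβ : Fact (IsPisot β)] : IsIntegral ℤ (gen β) := by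
  have h : IsIntegral ℤ (algebraMap (BetaField β) ℝ (gen β)) := by
    simpa [gen] using hβ.out.isIntegral
  exact (isIntegral_algebraMap_iff (algebraMap (BetaField β) ℝ).injective).1 h

/-- `β` as an element of the ring of integers of `ℚ(β)`. -/
noncomputable def genInt (β : ℝ) [Fact (IsPisot β)] : 𝓞 (BetaField β) := ⟨gen β, isIntegral_gen β⟩

/-- The norm `N(β)`. -/
noncomputable def normBeta (β : ℝ) [Fact (IsPisot β)] : ℤ := Algebra.norm ℤ (genInt β)

/-- `ℤ_(N(β))`: the rational numbers `p / q` with `gcd(q, N(β)) = 1`. -/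
def ZN (β : ℝ) [Fact (IsPisot β)] : Set ℚ := {x | Int.gcd x.den (normBeta β) = 1}

/-- The function `γ`. -/
noncomputable def gamma (β : ℝ) [Fact (IsPisot β)] : ℝ :=
  sSup {v : ℝ | v ∈ Set.Icc (0 : ℝ) 1 ∧
    ∀ x : ℚ, 0 < x → (x : ℝ) ≤ v → x ∈ ZN β → (x : ℝ) ∈ purelyPeriodic β}

/-- The real embeddings of `ℚ(β)` other than the inclusion in `ℝ`. -/
abbrev RealConj (β : ℝ) : Type := {τ : BetaField β →+* ℝ // τ ≠ algebraMap (BetaField β) ℝ}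

/-- The non-real complex embeddings of `ℚ(β)`, one out of each pair of complex conjugates: the one
that sends `β` to the upper half plane. -/
abbrev ComplexConj (β : ℝ) : Type := {τ : BetaField β →+* ℂ // 0 < (τ (gen β)).im}

/-- The Euclidean representation space `K_∞ = ℝ^{r-1} × ℂ^s`. -/
abbrev KInf (β : ℝ) : Type := (RealConj β → ℝ) × (ComplexConj β → ℂ)

/-- The embedding `φ_∞`. -/
noncomputable def phiInf (β : ℝ) (x : BetaField β) : KInf β := (fun τ => τ.1 x, fun τ => τ.1 x)

/-- The diagonal point `Δ_∞(t) = (t, …, t)`. -/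
noncomputable def diag (β : ℝ) (t : ℝ) : KInf β := (fun _ => t, fun _ => (t : ℂ))

/-- The prime ideals of the ring of integers of `ℚ(β)` which contain `β`. -/
abbrev PrimesAbove (β : ℝ) [Fact (IsPisot β)] : Type :=
  {P : IsDedekindDomain.HeightOneSpectrum (𝓞 (BetaField β)) // genInt β ∈ P.asIdeal}

/-- `K_f`, the product of the completions of `ℚ(β)` at the prime ideals which contain `β`. -/
abbrev KFin (β : ℝ) [Fact (IsPisot β)] : Type :=
  (P : PrimesAbove β) → P.1.adicCompletion (BetaField β)

/-- The embedding `φ_f`. -/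
noncomputable def phiFin (β : ℝ) [Fact (IsPisot β)] (x : BetaField β) : KFin β :=
  fun P => algebraMap (BetaField β) (P.1.adicCompletion (BetaField β)) x

/-- The complete representation space `K_β = K_∞ × K_f`. -/
abbrev KBeta (β : ℝ) [Fact (IsPisot β)] : Type := KInf β × KFin β

/-- The embedding `φ_β`. -/
noncomputable def phi (β : ℝ) [Fact (IsPisot β)] (x : BetaField β) : KBeta β :=
  (phiInf β x, phiFin β x)

/-! ### Tiles and stripes -/

/-- The number `w_p β^p + … + w_0` for a string `w = w_p … w_0`. -/
noncomputable def value (β : ℝ) (w : List ℕ) : BetaField β := Nat.ofDigits (gen β) w.reverse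

/-- The set `Int(β)` of integers in base `β`. -/
noncomputable def betaInt (β : ℝ) : Set (BetaField β) := value β '' {w | Admissible β w}

/-- The complete central tile. -/
noncomputable def tile (β : ℝ) [Fact (IsPisot β)] : Set (KBeta β) := closure (phi β '' betaInt β)

/-- The complete central subtile of the node `a`: the closure of the image of the integers in base
`β` whose expansion is in the language of `a`. Leading zeros in a string change neither its value
nor the node to which it leads, since `0` labels a loop at the node `1`. -/
noncomputable def subtile (β : ℝ) [Fact (IsPisot β)] (a : ℕ) : Set (KBeta β) :=
  closure (phi β '' (value β '' language β a))

/-- The stripe `Δ_∞([s, t]) × closure (φ_f (ℤ_(N(β))))`. -/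
noncomputable def stripe (β : ℝ) [Fact (IsPisot β)] (s t : ℝ) : Set (KBeta β) :=
  (diag β '' Set.Icc s t) ×ˢ closure ((fun x : ℚ => phiFin β (x : BetaField β)) '' ZN β)

/-- The union of the sets `-T̃^(a_j)` for `k ≤ j ≤ n`. -/
noncomputable def negSubtiles (β : ℝ) [Fact (IsPisot β)] (a : ℕ → ℕ) (k : ℕ) : Set (KBeta β) :=
  ⋃ j ∈ Set.Icc k (size β), -subtile β (a j)

end PisotBeta

namespace PisotBeta

/-! ### The beta-transformation -/

/-! The theorem rests on an algebraic natural extension of `T`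
(`mem_purelyPeriodic_iff_exists_subtile`): an element `z` of the field with `0 ≤ z < 1` has purely
periodic expansion iff, for some node `a`, `z < T^{a-1}(1)` and `φ_β(z)` lies in minus the subtile
of `a`.

If `T^l z = z`, the first `lj` digits of `z` form a string of value `β^{lj} z - z`. Its image under
`φ_β` tends to `-φ_β(z)`, since powers of `β` tend to `0` in the representation space. The string
ends at a node `a` with `z < T^{a-1}(1)`. There are finitely many nodes, so the limit lies in one of
these subtiles.

Conversely, each point of a subtile is `β` times a point of the subtile of a preceding node, plus
the label of the edge. So every `z` in the extension domain has a `T`-preimage `(z + ε)/β` in it.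
Such preimages have bounded conjugates, are integral at the primes above `β`, and gain no
denominators elsewhere; hence they stay in a finite set. A right inverse of `T` on a finite set is
injective, so all its points are periodic.

For `x` in `[θ_{k-1}, θ_k)` the condition `x < T^{a-1}(1)` selects exactly the nodes `a_j` with `j ≥
k`. What remains is topology: the points `φ_β(x)`, with `x` in `ℤ_(N(β))` inside an open interval,
are dense in the stripe (`stripe_subset_of_forall_ZN`), and the subtiles are closed. -/

theorem T_iterate_succ (β x : ℝ) (i : ℕ) : (T β)^[i + 1] x = Int.fract (β * (T β)^[i] x) := by
  rw [Function.iterate_succ_apply', T]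

theorem T_iterate_mem_Ico (β : ℝ) {x : ℝ} (hx : x ∈ Set.Ico (0 : ℝ) 1) (i : ℕ) :
    (T β)^[i] x ∈ Set.Ico (0 : ℝ) 1 := by
  cases i with
  | zero => exact hx
  | succ i => rw [T_iterate_succ]; exact ⟨Int.fract_nonneg _, Int.fract_lt_one _⟩

theorem T_iterate_one_mem (β : ℝ) (i : ℕ) : (T β)^[i] 1 ∈ Set.Icc (0 : ℝ) 1 := by
  cases i with
  | zero => simp
  | succ i => rw [T_iterate_succ]; exact ⟨Int.fract_nonneg _, (Int.fract_lt_one _).le⟩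

theorem mul_T_iterate {β x : ℝ} (hβ : 0 ≤ β) {i : ℕ} (hx : 0 ≤ (T β)^[i] x) :
    β * (T β)^[i] x = digit β x i + (T β)^[i + 1] x := by
  rw [T_iterate_succ, digit, natCast_floor_eq_intCast_floor (mul_nonneg hβ hx),
    Int.floor_add_fract]

theorem digit_add (β x : ℝ) (k i : ℕ) : digit β ((T β)^[k] x) i = digit β x (k + i) := by
  rw [digit, digit, ← Function.iterate_add_apply, add_comm]

/-- Orbits of expanding affine maps with the same translations separate points. -/
theorem pow_mul_sub_eq {β : ℝ} {u v : ℕ → ℝ} {d : ℕ → ℕ}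
    (hu : ∀ i, β * u i = d i + u (i + 1)) {k : ℕ} (hv : ∀ i < k, β * v i = d i + v (i + 1)) :
    u k - v k = β ^ k * (u 0 - v 0) := by
  induction k with
  | zero => simp
  | succ k ih =>
    rw [pow_succ', mul_assoc, ← ih fun i hi => hv i (by omega)]
    linarith [hu k, hv k (by omega)]

/-- The difference of the orbits grows like `β^k`, yet both stay in `[0,1]`. Both endpoints are
allowed, so that greedy and quasi-greedy orbits can be compared. -/
theorem eq_of_same_digits {β : ℝ} (hβ : 1 < β) {u v : ℕ → ℝ} {d : ℕ → ℕ}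
    (hu : ∀ i, β * u i = d i + u (i + 1)) (hv : ∀ i, β * v i = d i + v (i + 1))
    (hu1 : ∀ i, u i ∈ Set.Icc (0 : ℝ) 1) (hv1 : ∀ i, v i ∈ Set.Icc (0 : ℝ) 1) : u 0 = v 0 := by
  by_contra hne
  obtain ⟨k, hk⟩ := pow_unbounded_of_one_lt (1 / |u 0 - v 0|) hβ
  have hpos : 0 < |u 0 - v 0| := abs_pos.2 (sub_ne_zero.2 hne)
  have h := pow_mul_sub_eq hu (k := k) fun i _ => hv i
  have h1 : |u k - v k| ≤ 1 :=
    abs_le.2 ⟨by linarith [(hu1 k).1, (hv1 k).2], by linarith [(hu1 k).2, (hv1 k).1]⟩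
  rw [h, abs_mul, abs_of_pos (by positivity : (0 : ℝ) < β ^ k)] at h1
  rw [div_lt_iff₀ hpos] at hk
  linarith

theorem mem_purelyPeriodic_iff {β : ℝ} (hβ : 1 < β) {x : ℝ} (hx : x ∈ Set.Ico (0 : ℝ) 1) :
    x ∈ purelyPeriodic β ↔ ∃ l, 0 < l ∧ (T β)^[l] x = x := by
  refine ⟨fun ⟨_, l, hl, h⟩ => ⟨l, hl, ?_⟩, fun ⟨l, hl, h⟩ => ⟨hx, l, hl, fun i => ?_⟩⟩
  · have hm := T_iterate_mem_Ico β hx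
    have hc : ∀ i, (T β)^[i] x ∈ Set.Icc (0 : ℝ) 1 := fun i => Set.Ico_subset_Icc_self (hm i)
    have := eq_of_same_digits hβ (u := fun i => (T β)^[i + l] x) (v := fun i => (T β)^[i] x)
      (d := digit β x) (fun i => ?_) (fun i => mul_T_iterate (by linarith) (hm i).1)
      (fun i => hc _) hc
    · simpa using this
    · rw [mul_T_iterate (by linarith) (hm _).1, h]
      simp only [add_right_comm]
  · rw [digit, digit, Function.iterate_add_apply, h]

theorem T_iterate_mul {β x : ℝ} {l : ℕ} (h : (T β)^[l] x = x) (j : ℕ) : (T β)^[l * j] x = x := by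
  rw [Function.iterate_mul, Function.iterate_fixed h]

/-! ### The quasi-greedy orbit of `1` -/

/-- The orbit of `1` along the digits of `d*_β(1)`. -/
noncomputable def quasiOrbit (β : ℝ) : ℕ → ℝ
  | 0 => 1
  | i + 1 => β * quasiOrbit β i - dstar β i

theorem mul_quasiOrbit (β : ℝ) (i : ℕ) :
    β * quasiOrbit β i = dstar β i + quasiOrbit β (i + 1) := by
  simp [quasiOrbit]

theorem T_iterate_add_eq_zero {β : ℝ} {N : ℕ} (h : (T β)^[N] 1 = 0) (j : ℕ) :
    (T β)^[N + j] 1 = 0 := by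
  induction j with
  | zero => exact h
  | succ j ih => rw [← add_assoc, T_iterate_succ, ih]; simp

theorem T_iterate_pos_of_digit_ne {β : ℝ} {i j : ℕ} (hij : i ≤ j) (h : digit β 1 j ≠ 0) :
    0 < (T β)^[i] 1 := by
  refine lt_of_le_of_ne (T_iterate_one_mem β i).1 fun h0 => h ?_
  obtain ⟨k, rfl⟩ := Nat.exists_eq_add_of_le hij
  simp [digit, T_iterate_add_eq_zero h0.symm k]

theorem T_iterate_eq_zero_of_digits {β : ℝ} (hβ : 1 < β) {N : ℕ}
    (h : ∀ j, N ≤ j → digit β 1 j = 0) : (T β)^[N] 1 = 0 := by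
  have := eq_of_same_digits hβ (u := fun i => (T β)^[N + i] 1) (v := fun _ => 0) (d := fun _ => 0)
    (fun i => ?_) (fun i => by simp) (fun i => T_iterate_one_mem β _) (fun i => by simp)
  · simpa using this
  · rw [mul_T_iterate (by linarith) (T_iterate_one_mem β _).1, h _ (by omega), add_assoc]

theorem dstar_cases {β : ℝ} (hβ : 1 < β) :
    ((∀ i, dstar β i = digit β 1 i) ∧ ∀ i, 0 < (T β)^[i] 1) ∨
    ∃ N, 0 < N ∧ (T β)^[N] 1 = 0 ∧ (∀ i < N, 0 < (T β)^[i] 1) ∧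
      ∀ i, dstar β i = if i % N = N - 1 then digit β 1 (i % N) - 1 else digit β 1 (i % N) := by
  classical
  by_cases h : ∃ N, ∀ j, N ≤ j → digit β 1 j = 0
  · right
    have hpos : ∀ i < Nat.find h, 0 < (T β)^[i] 1 := fun i hi => by
      have := Nat.find_min h hi
      push Not at this
      obtain ⟨j, hj, hd⟩ := this
      exact T_iterate_pos_of_digit_ne hj hd
    have h0 := T_iterate_eq_zero_of_digits hβ (Nat.find_spec h)
    refine ⟨Nat.find h, ?_, h0, hpos, fun i => ?_⟩
    · refine Nat.pos_of_ne_zero fun hN => ?_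
      rw [hN] at h0
      simp at h0
    · unfold dstar
      rw [dif_pos h]
  · left
    refine ⟨fun i => by unfold dstar; rw [dif_neg h], fun i => ?_⟩
    push Not at h
    obtain ⟨j, hj, hd⟩ := h i
    exact T_iterate_pos_of_digit_ne hj hd

/-- When `d_β(1)` is finite of length `N`, lowering the last digit by one sends the orbit back to
`1` where the greedy orbit would reach `0`. The orbit therefore stays positive. -/
theorem quasiOrbit_cases {β : ℝ} (hβ : 1 < β) :
    ((∀ i, quasiOrbit β i = (T β)^[i] 1) ∧ ∀ i, 0 < (T β)^[i] 1) ∨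
    ∃ N, 0 < N ∧ (∀ i < N, 0 < (T β)^[i] 1) ∧ ∀ i, quasiOrbit β i = (T β)^[i % N] 1 := by
  have hT := fun i => mul_T_iterate (x := 1) (by linarith : 0 ≤ β) (T_iterate_one_mem β i).1
  rcases dstar_cases hβ with ⟨hd, hp⟩ | ⟨N, hN, h0, hp, hd⟩
  · refine .inl ⟨fun i => ?_, hp⟩
    induction i with
    | zero => rfl
    | succ i ih => rw [quasiOrbit, ih, hT, hd]; ring
  · refine .inr ⟨N, hN, hp, fun i => ?_⟩
    induction i with
    | zero => simp [quasiOrbit]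
    | succ i ih =>
      have hlt := Nat.mod_lt i hN
      rw [quasiOrbit, ih, hT, hd]
      split_ifs with h
      · have h1 : (i + 1) % N = 0 := by
          rw [Nat.add_mod_eq_ite]
          rcases Nat.lt_or_ge 1 N with h1 | h1
          · rw [Nat.mod_eq_of_lt h1]; split_ifs <;> omega
          · obtain rfl : N = 1 := by omega
            simp [Nat.mod_one]
        have h2 : (T β)^[i % N + 1] 1 = 0 := by rw [h, Nat.sub_add_cancel hN, h0]
        have h3 : 1 ≤ digit β 1 (i % N) := by
          have h4 := hT (i % N)
          have h5 : 0 < β * (T β)^[i % N] 1 := mul_pos (by linarith) (hp _ hlt)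
          rw [h2, add_zero] at h4
          rw [h4] at h5
          exact_mod_cast h5
        rw [h1, h2]
        push_cast [h3]
        simp
      · have h1 : (i + 1) % N = i % N + 1 := by
          rw [Nat.add_mod_eq_ite, Nat.mod_eq_of_lt (by omega : 1 < N), if_neg (by omega)]
        rw [h1]; ring

theorem quasiOrbit_mem {β : ℝ} (hβ : 1 < β) (i : ℕ) : quasiOrbit β i ∈ Set.Ioc (0 : ℝ) 1 := by
  rcases quasiOrbit_cases hβ with ⟨h, hp⟩ | ⟨N, hN, hp, h⟩
  · rw [h]; exact ⟨hp i, (T_iterate_one_mem β i).2⟩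
  · rw [h]; exact ⟨hp _ (Nat.mod_lt _ hN), (T_iterate_one_mem β _).2⟩

/-- The orbit lies in the half-open unit interval `(0,1]`, so a point determines its digit and its
successor. -/
theorem dstar_eq_of_quasiOrbit_eq {β : ℝ} (hβ : 1 < β) {i j : ℕ}
    (h : quasiOrbit β i = quasiOrbit β j) :
    dstar β i = dstar β j ∧ quasiOrbit β (i + 1) = quasiOrbit β (j + 1) := by
  have hi := mul_quasiOrbit β i
  have hj := mul_quasiOrbit β j
  obtain ⟨h1, h2⟩ := quasiOrbit_mem hβ (i + 1)
  obtain ⟨h3, h4⟩ := quasiOrbit_mem hβ (j + 1)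
  rw [h] at hi
  have hd : dstar β i = dstar β j := by
    have h5 : (dstar β i : ℝ) < dstar β j + 1 := by linarith
    have h6 : (dstar β j : ℝ) < dstar β i + 1 := by linarith
    norm_cast at h5 h6
    omega
  refine ⟨hd, ?_⟩
  rw [hd] at hi
  linarith

theorem quasiOrbit_eq_iff {β : ℝ} (hβ : 1 < β) (i j : ℕ) :
    quasiOrbit β i = quasiOrbit β j ↔ ∀ k, dstar β (i + k) = dstar β (j + k) := by
  constructor
  · intro h k
    have : ∀ k, quasiOrbit β (i + k) = quasiOrbit β (j + k) := fun k => by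
      induction k with
      | zero => exact h
      | succ k ih => exact (dstar_eq_of_quasiOrbit_eq hβ ih).2
    exact (dstar_eq_of_quasiOrbit_eq hβ (this k)).1
  · intro h
    have hc : ∀ i, quasiOrbit β i ∈ Set.Icc (0 : ℝ) 1 := fun i =>
      Set.Ioc_subset_Icc_self (quasiOrbit_mem hβ i)
    exact eq_of_same_digits hβ (u := fun k => quasiOrbit β (i + k))
      (v := fun k => quasiOrbit β (j + k)) (d := fun k => dstar β (i + k))
      (fun k => mul_quasiOrbit β _) (fun k => by rw [h k]; exact mul_quasiOrbit β _)
      (fun k => hc _) (fun k => hc _)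

theorem periodic_from_iff {β : ℝ} (hβ : 1 < β) (m p : ℕ) :
    (∀ i, m ≤ i → dstar β (i + p) = dstar β i) ↔ quasiOrbit β (m + p) = quasiOrbit β m := by
  rw [quasiOrbit_eq_iff hβ]
  refine ⟨fun h k => by rw [add_right_comm]; exact h _ (by omega), fun h i hi => ?_⟩
  obtain ⟨k, rfl⟩ := Nat.exists_eq_add_of_le hi
  rw [add_right_comm]; exact h k

theorem preperiod_le {β : ℝ} (hβ : 1 < β) {m p : ℕ} (hp : 0 < p) (h : quasiOrbit β (m + p) = quasiOrbit β m) :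
    preperiod β ≤ m :=
  Nat.sInf_le ⟨p, hp, (periodic_from_iff hβ _ _).2 h⟩

theorem period_le {β : ℝ} (hβ : 1 < β) {p : ℕ} (hp : 0 < p)
    (h : quasiOrbit β (preperiod β + p) = quasiOrbit β (preperiod β)) : period β ≤ p :=
  Nat.sInf_le ⟨hp, (periodic_from_iff hβ _ _).2 h⟩

/-- For finite `d_β(1)` the two orbits part at index `N`, but the return to `1` at `N` forces
preperiod `0` and period at most `N`. -/
theorem quasiOrbit_eq_T_iterate {β : ℝ} (hβ : 1 < β) {i : ℕ} (hi : i < size β) : quasiOrbit β i = (T β)^[i] 1 := by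
  rcases quasiOrbit_cases hβ with ⟨h, -⟩ | ⟨N, hN, -, h⟩
  · exact h i
  · have h0 : quasiOrbit β (0 + N) = quasiOrbit β 0 := by simp [h]
    have hm := preperiod_le hβ hN h0
    have hm' : preperiod β = 0 := by omega
    have := period_le hβ hN (by rw [hm', h0])
    have := size.eq_1 β
    rw [h, Nat.mod_eq_of_lt (by omega)]

/-! ### Minimality of the preperiod and the period. -/

section EventuallyPeriodic

variable {β : ℝ} (hβ : 1 < β) (hfin : (Set.range (quasiOrbit β)).Finite)

include hβ hfin

theorem preperiod_spec :
    ∃ p, 0 < p ∧ quasiOrbit β (preperiod β + p) = quasiOrbit β (preperiod β) := by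
  have hne : {m | ∃ p, 0 < p ∧ ∀ i, m ≤ i → dstar β (i + p) = dstar β i}.Nonempty := by
    obtain ⟨i, -, j, -, hij, h⟩ := Set.infinite_univ.exists_lt_map_eq_of_mapsTo
      (f := quasiOrbit β) (t := Set.range (quasiOrbit β)) (fun i _ => ⟨i, rfl⟩) hfin
    refine ⟨i, j - i, by omega, (periodic_from_iff hβ _ _).2 ?_⟩
    rw [Nat.add_sub_cancel' hij.le, h]
  obtain ⟨p, hp, h⟩ := Nat.sInf_mem hne
  exact ⟨p, hp, (periodic_from_iff hβ _ _).1 h⟩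

theorem period_spec :
    0 < period β ∧ quasiOrbit β (size β) = quasiOrbit β (preperiod β) := by
  obtain ⟨p, hp, h⟩ := preperiod_spec hβ hfin
  have := Nat.sInf_mem (s := {p | 0 < p ∧ ∀ i, preperiod β ≤ i → dstar β (i + p) = dstar β i})
    ⟨p, hp, (periodic_from_iff hβ _ _).2 h⟩
  exact ⟨this.1, (periodic_from_iff hβ _ _).1 this.2⟩

theorem size_pos : 0 < size β := Nat.add_pos_right _ (period_spec hβ hfin).1

theorem quasiOrbit_injOn : Set.InjOn (quasiOrbit β) (Set.Iio (size β)) := by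
  have key : ∀ i j, i < j → j < size β → quasiOrbit β i ≠ quasiOrbit β j := by
    intro i j hij hj h
    have hi : preperiod β ≤ i := preperiod_le hβ (p := j - i) (by omega)
      (by rw [Nat.add_sub_cancel' hij.le, h])
    have hs : ∀ k, quasiOrbit β (i + k) = quasiOrbit β (j + k) := fun k => by
      induction k with
      | zero => exact h
      | succ k ih => exact (dstar_eq_of_quasiOrbit_eq hβ ih).2
    have h1 := hs (size β - j)
    rw [Nat.add_sub_cancel' hj.le, (period_spec hβ hfin).2] at h1
    -- A coincidence at `i < j` persists along the orbit. Moved forward to index `size β`, it yields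
    -- a period shorter by `j - i` than the minimal one.
    have h2 := period_le hβ (p := i + (size β - j) - preperiod β) (by omega)
      (by rw [Nat.add_sub_cancel' (by omega), h1])
    have := size.eq_1 β
    omega
  intro i hi j hj h
  rcases lt_trichotomy i j with hij | hij | hij
  · exact absurd h (key i j hij hj)
  · exact hij
  · exact absurd h.symm (key j i hij hi)

end EventuallyPeriodic

/-! ### Reading expansions in the admissibility graph -/

theorem LexLT.trans {u v w : ℕ → ℕ} (h : LexLT u v) (h' : LexLT v w) : LexLT u w := by
  obtain ⟨k, hk, hk'⟩ := h
  obtain ⟨l, hl, hl'⟩ := h'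
  rcases lt_trichotomy k l with hkl | rfl | hkl
  · exact ⟨k, fun i hi => (hk i hi).trans (hl i (hi.trans hkl)), by rwa [← hl k hkl]⟩
  · exact ⟨k, fun i hi => (hk i hi).trans (hl i hi), hk'.trans hl'⟩
  · exact ⟨l, fun i hi => (hk i (hi.trans hkl)).trans (hl i hi), by rwa [hk l hkl]⟩

theorem eq_or_lexLT_of_le {u v : ℕ → ℕ} (h : ∀ i, u i ≠ v i → (∀ j < i, u j = v j) → u i < v i) :
    u = v ∨ LexLT u v := by
  classical
  by_cases hne : ∃ i, u i ≠ v i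
  · exact .inr ⟨Nat.find hne, fun i hi => not_not.1 (Nat.find_min hne hi),
      h _ (Nat.find_spec hne) fun i hi => not_not.1 (Nat.find_min hne hi)⟩
  · push Not at hne
    exact .inl (funext hne)

/-- If `u ≤ v` digitwise then `u` is not lexicographically larger than `v`. -/
theorem LexLT.of_le {u v w : ℕ → ℕ} (h : ∀ i, u i ≤ v i) (h' : LexLT v w) : LexLT u w := by
  rcases eq_or_lexLT_of_le (u := u) (v := v) fun i hi _ => lt_of_le_of_ne (h i) hi with rfl | h1
  · exact h'
  · exact h1.trans h'

theorem Admissible.of_append {β : ℝ} {w w' : List ℕ} (h : Admissible β (w ++ w')) :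
    Admissible β w := by
  refine ⟨fun d hd => h.1 d (by simp [hd]), fun k => (h.2 k).of_le fun i => ?_⟩
  rcases lt_or_ge (k + i) w.length with h1 | h1
  · rw [List.getD_append _ _ _ _ h1]
  · rw [List.getD_eq_default _ _ h1]; exact Nat.zero_le _

theorem leads_append_singleton_iff {β : ℝ} {b a ε : ℕ} {w : List ℕ} :
    Leads β b (w ++ [ε]) a ↔ ∃ c, Leads β b w c ∧ Edge β c ε a := by
  induction w generalizing b with
  | nil =>
    constructor
    · rintro (_ | ⟨h, h'⟩)
      cases h'
      exact ⟨b, .nil b, h⟩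
    · rintro ⟨c, h, h'⟩
      cases h
      exact .cons h' (.nil a)
  | cons d w ih =>
    constructor
    · intro h
      cases h with
      | cons h h' =>
        obtain ⟨c, h1, h2⟩ := ih.1 h'
        exact ⟨c, .cons h h1, h2⟩
    · rintro ⟨c, h, h'⟩
      cases h with
      | cons h1 h2 => exact .cons h1 (ih.2 ⟨c, h2, h'⟩)

/-- The string of the first `k` digits of the beta-expansion of `x`. -/
noncomputable def digits (β x : ℝ) (k : ℕ) : List ℕ := (List.range k).map (digit β x)

theorem digits_succ (β x : ℝ) (k : ℕ) : digits β x (k + 1) = digits β x k ++ [digit β x k] := by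
  simp [digits, List.range_succ]

theorem digit_lt_ceil {β x : ℝ} (hβ : 1 < β) (hx : x ∈ Set.Ico (0 : ℝ) 1) (i : ℕ) :
    digit β x i < ⌈β⌉₊ := by
  have hm := T_iterate_mem_Ico β hx
  have h := mul_T_iterate (by linarith : 0 ≤ β) (hm i).1
  have h1 : (digit β x i : ℝ) < β := by nlinarith [(hm i).1, (hm i).2, (hm (i + 1)).1]
  exact_mod_cast h1.trans_le (Nat.le_ceil β)

theorem digit_le_of_lt {β x : ℝ} (hβ : 1 < β) (hx : x ∈ Set.Ico (0 : ℝ) 1) {i j : ℕ}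
    (h : (T β)^[i] x < quasiOrbit β j) : digit β x i ≤ dstar β j := by
  have hm := T_iterate_mem_Ico β hx
  have h1 := mul_T_iterate (by linarith : 0 ≤ β) (hm i).1
  have h2 := mul_quasiOrbit β j
  have h3 : β * (T β)^[i] x < β * quasiOrbit β j := by gcongr
  have h4 : (digit β x i : ℝ) < dstar β j + 1 := by
    linarith [(hm (i + 1)).1, (quasiOrbit_mem hβ (j + 1)).2]
  norm_cast at h4
  omega

theorem T_iterate_succ_lt {β x : ℝ} (hβ : 1 < β) (hx : x ∈ Set.Ico (0 : ℝ) 1) {i j : ℕ}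
    (h : (T β)^[i] x < quasiOrbit β j) (hd : digit β x i = dstar β j) :
    (T β)^[i + 1] x < quasiOrbit β (j + 1) := by
  have h1 := mul_T_iterate (by linarith : 0 ≤ β) (T_iterate_mem_Ico β hx i).1
  have h2 := mul_quasiOrbit β j
  have h3 : β * (T β)^[i] x < β * quasiOrbit β j := by gcongr
  rw [hd] at h1
  linarith

/-- As long as the digits agree, the strict inequality `x < 1` propagates to `T^i x < quasiOrbit β
i`, so the first differing digit is smaller. Full agreement would give `x = 1`. -/
theorem digit_lexLT {β x : ℝ} (hβ : 1 < β) (hx : x ∈ Set.Ico (0 : ℝ) 1) :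
    LexLT (digit β x) (dstar β) := by
  have hlt : ∀ i, (∀ j < i, digit β x j = dstar β j) → (T β)^[i] x < quasiOrbit β i := by
    intro i
    induction i with
    | zero => exact fun _ => hx.2
    | succ i ih =>
      exact fun h => T_iterate_succ_lt hβ hx (ih fun j hj => h j (by omega)) (h i (by omega))
  refine (eq_or_lexLT_of_le fun i hi h =>
    lt_of_le_of_ne (digit_le_of_lt hβ hx (hlt i h)) hi).resolve_left fun h => ?_
  have := eq_of_same_digits hβ (u := fun i => (T β)^[i] x) (v := quasiOrbit β) (d := digit β x)
    (fun i => mul_T_iterate (by linarith) (T_iterate_mem_Ico β hx i).1)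
    (fun i => by rw [congrFun h i]; exact mul_quasiOrbit β i)
    (fun i => Set.Ico_subset_Icc_self (T_iterate_mem_Ico β hx i))
    (fun i => Set.Ioc_subset_Icc_self (quasiOrbit_mem hβ i))
  exact hx.2.ne this

theorem admissible_digits {β x : ℝ} (hβ : 1 < β) (hx : x ∈ Set.Ico (0 : ℝ) 1) (k : ℕ) :
    Admissible β (digits β x k) := by
  refine ⟨fun d hd => ?_, fun j => ?_⟩
  · obtain ⟨i, -, rfl⟩ := List.mem_map.1 hd
    exact digit_lt_ceil hβ hx i
  · refine (digit_lexLT hβ (T_iterate_mem_Ico β hx j)).of_le fun i => ?_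
    rw [digit_add]
    rcases lt_or_ge (j + i) k with h | h
    · rw [List.getD_eq_getElem _ _ (by simpa [digits] using h)]
      simp [digits]
    · rw [List.getD_eq_default _ _ (by simpa [digits] using h)]; exact Nat.zero_le _

/-! ### The graph keeps track of upper bounds for the orbit. -/

section Graph

variable {β : ℝ} (hβ : 1 < β) (hfin : (Set.range (quasiOrbit β)).Finite)

include hβ hfin

theorem edge_mem {b ε a : ℕ} (h : Edge β b ε a) : a ∈ Set.Icc 1 (size β) := by
  have := size_pos hβ hfin
  have := (period_spec hβ hfin).1
  have := size.eq_1 β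
  obtain ⟨-, ⟨-, rfl⟩ | ⟨-, h, rfl⟩ | ⟨-, -, rfl⟩⟩ := h <;> constructor <;> omega

/-- An edge either carries a digit below `t_b` and ends at `1`, or carries `t_b` and follows the orbit
of `1`. -/
theorem edge_cases {b ε a : ℕ} (h : Edge β b ε a) :
    (ε < dstar β (b - 1) ∧ a = 1) ∨
      (ε = dstar β (b - 1) ∧ quasiOrbit β (a - 1) = quasiOrbit β b) := by
  obtain ⟨hb, h | ⟨h, -, rfl⟩ | ⟨h, rfl, rfl⟩⟩ := h
  · exact .inl h
  · exact .inr ⟨h, rfl⟩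
  · exact .inr ⟨h, (period_spec hβ hfin).2.symm⟩

/-- This is the bound at a node carried backwards along an edge; `exists_leads_digits` carries it
forwards. Together they make the graph describe the natural extension. -/
theorem lt_of_edge {b ε a : ℕ} (h : Edge β b ε a) {x : ℝ} (hx : x ∈ Set.Ico (0 : ℝ) 1)
    (hxa : x < quasiOrbit β (a - 1)) :
    (x + ε) / β ∈ Set.Ico (0 : ℝ) 1 ∧ (x + ε) / β < quasiOrbit β (b - 1) := by
  have hβ0 : 0 < β := by linarith
  have key : (x + ε) / β < quasiOrbit β (b - 1) := by
    rw [div_lt_iff₀ hβ0, mul_comm, mul_quasiOrbit, Nat.sub_add_cancel h.1.1]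
    rcases edge_cases hβ hfin h with ⟨h1, -⟩ | ⟨h1, h2⟩
    · have h3 : (ε : ℝ) + 1 ≤ dstar β (b - 1) := by exact_mod_cast h1
      linarith [hx.2, (quasiOrbit_mem hβ b).1]
    · rw [h1]; linarith
  refine ⟨⟨?_, key.trans_le (quasiOrbit_mem hβ _).2⟩, key⟩
  have := hx.1
  positivity

theorem exists_leads_digits {x : ℝ} (hx : x ∈ Set.Ico (0 : ℝ) 1) (k : ℕ) :
    ∃ a ∈ Set.Icc 1 (size β), Leads β 1 (digits β x k) a ∧
      (T β)^[k] x < quasiOrbit β (a - 1) := by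
  induction k with
  | zero => exact ⟨1, ⟨le_rfl, size_pos hβ hfin⟩, .nil 1, hx.2⟩
  | succ k ih =>
    obtain ⟨b, hb, hL, hlt⟩ := ih
    suffices h : ∃ a, Edge β b (digit β x k) a ∧ (T β)^[k + 1] x < quasiOrbit β (a - 1) by
      obtain ⟨a, he, h⟩ := h
      exact ⟨a, edge_mem hβ hfin he,
        by rw [digits_succ]; exact leads_append_singleton_iff.2 ⟨b, hL, he⟩, h⟩
    rcases (digit_le_of_lt hβ hx hlt).lt_or_eq with h | h
    · exact ⟨1, ⟨hb, .inl ⟨h, rfl⟩⟩, (T_iterate_mem_Ico β hx (k + 1)).2⟩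
    · have h1 := T_iterate_succ_lt hβ hx hlt h
      rw [Nat.sub_add_cancel hb.1] at h1
      rcases hb.2.lt_or_eq with h2 | h2
      · exact ⟨b + 1, ⟨hb, .inr (.inl ⟨h, h2, rfl⟩)⟩, h1⟩
      -- The last node returns to `m + 1` because the orbit takes the same value at the indices `n`
      -- and `m`.
      · refine ⟨preperiod β + 1, ⟨hb, .inr (.inr ⟨h, h2, rfl⟩)⟩, ?_⟩
        rwa [h2, (period_spec hβ hfin).2] at h1

theorem exists_isOrbitOrdering : ∃ a : ℕ → ℕ, IsOrbitOrdering β a := by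
  have hinj : Set.InjOn (fun b => (T β)^[b - 1] 1) (Set.Icc 1 (size β)) := by
    intro i hi j hj h
    have h1 : i - 1 < size β := by have := hi.1; have := hi.2; omega
    have h2 : j - 1 < size β := by have := hj.1; have := hj.2; omega
    have := quasiOrbit_injOn hβ hfin h1 h2 (by
      rw [quasiOrbit_eq_T_iterate hβ h1, quasiOrbit_eq_T_iterate hβ h2]; exact h)
    have := hi.1
    have := hj.1
    omega
  set S : Finset ℝ := (Finset.Icc 1 (size β)).image fun b => (T β)^[b - 1] 1 with hS
  have hcard : S.card = size β := by
    rw [hS, Finset.card_image_of_injOn (by simpa using hinj)]; simp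
  have hex : ∀ k : Fin (size β), ∃ b ∈ Set.Icc 1 (size β),
      (T β)^[b - 1] 1 = S.orderEmbOfFin hcard k := fun k => by
    simpa using Finset.mem_image.1 (S.orderEmbOfFin_mem hcard k)
  choose f hf hf' using hex
  set a : ℕ → ℕ := fun k => if h : k - 1 < size β then f ⟨k - 1, h⟩ else 0 with ha
  have hlt : ∀ k ∈ Set.Icc 1 (size β), k - 1 < size β := fun k hk => by
    have := hk.1; have := hk.2; omega
  have hmono : StrictMonoOn (fun k => (T β)^[a k - 1] 1) (Set.Icc 1 (size β)) := by
    intro i hi j hj hij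
    simp only [ha, dif_pos (hlt i hi), dif_pos (hlt j hj), hf']
    refine (S.orderEmbOfFin hcard).strictMono (Fin.mk_lt_mk.2 ?_)
    have := hi.1
    omega
  have hmaps : Set.MapsTo a (Set.Icc 1 (size β)) (Set.Icc 1 (size β)) := fun k hk => by
    simp only [ha, dif_pos (hlt k hk)]; exact hf _
  have hinj' : Set.InjOn a (Set.Icc 1 (size β)) := fun i hi j hj h =>
    hmono.injOn hi hj (by simp only [h])
  refine ⟨a, ⟨hmaps, hinj', ?_⟩, hmono⟩
  have h1 : Set.MapsTo a (Finset.Icc 1 (size β)) (Finset.Icc 1 (size β)) := by simpa using hmaps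
  simpa using Finset.surjOn_of_injOn_of_card_le a h1 (by simpa using hinj') le_rfl

end Graph

/-! ### Embeddings and valuations of `ℚ(β)` -/

section Field

@[simp]
theorem coe_gen (β : ℝ) : ((gen β : BetaField β) : ℝ) = β := IntermediateField.AdjoinSimple.coe_gen ℚ β

/-- The orbit of `1` along the digits of `d*_β(1)`, as elements of `ℚ(β)`. -/
noncomputable def quasiOrbitField (β : ℝ) : ℕ → BetaField β
  | 0 => 1
  | i + 1 => gen β * quasiOrbitField β i - (dstar β i : BetaField β)

theorem coe_quasiOrbitField {β : ℝ} (i : ℕ) : (quasiOrbitField β i : ℝ) = quasiOrbit β i := by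
  induction i with
  | zero => rfl
  | succ i ih =>
    rw [quasiOrbitField, quasiOrbit, ← ih]
    push_cast
    rw [coe_gen]

@[simp]
theorem value_nil {β : ℝ} : value β [] = 0 := rfl

theorem value_append_singleton {β : ℝ} (w : List ℕ) (ε : ℕ) :
    value β (w ++ [ε]) = gen β * value β w + ε := by
  simp [value, Nat.ofDigits, add_comm]

theorem complexConj_gen_ne {β : ℝ} (τ : ComplexConj β) : τ.1 (gen β) ≠ (β : ℂ) := fun h => by
  have := τ.2
  rw [h] at this
  simp at this

variable (β : ℝ) [hβ : Fact (IsPisot β)]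

theorem gen_ne_zero : gen β ≠ 0 := fun h => by
  have h1 := congrArg (Subtype.val) h
  have h2 := hβ.out.one_lt
  rw [coe_gen] at h1
  simp only [ZeroMemClass.coe_zero] at h1
  linarith

theorem ringHom_ext_gen {L : Type*} [Field L] [CharZero L] {τ τ' : BetaField β →+* L}
    (h : τ (gen β) = τ' (gen β)) : τ = τ' := by
  have : τ.toRatAlgHom = τ'.toRatAlgHom := by
    refine IntermediateField.adjoin_algHom_ext ℚ fun x hx => ?_
    obtain rfl : x = β := hx
    exact h
  ext x
  exact DFunLike.congr_fun this x

theorem norm_gen_lt_one {τ : BetaField β →+* ℂ} (h : τ (gen β) ≠ (β : ℂ)) : ‖τ (gen β)‖ < 1 := by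
  refine hβ.out.norm_conj_lt_one _ ?_ h
  have h1 : Polynomial.aeval (gen β) (minpoly ℚ β) = 0 := by
    rw [← IntermediateField.minpoly_gen ℚ β]; exact minpoly.aeval _ _
  have h2 := Polynomial.aeval_algHom_apply τ.toRatAlgHom (gen β) (minpoly ℚ β)
  rw [h1, map_zero] at h2
  exact h2

theorem apply_eq_of_apply_gen {τ : BetaField β →+* ℂ} (h : τ (gen β) = (β : ℂ))
    (x : BetaField β) : τ x = ((x : ℝ) : ℂ) := by
  have : τ = Complex.ofRealHom.comp (algebraMap (BetaField β) ℝ) := ringHom_ext_gen β <| by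
    rw [h]; simp [IntermediateField.algebraMap_apply]
  rw [this]; rfl

/-- A bound for the conjugates of the integers in base `β`. -/
noncomputable def conjBound (τ : BetaField β →+* ℂ) : ℝ := ⌈β⌉₊ / (1 - ‖τ (gen β)‖)

variable {β}

theorem conjBound_nonneg {τ : BetaField β →+* ℂ} (h : τ (gen β) ≠ (β : ℂ)) :
    0 ≤ conjBound β τ :=
  div_nonneg (Nat.cast_nonneg _) (by linarith [norm_gen_lt_one β h])

/-- The bound is the fixed point of `r ↦ ‖τ β‖ r + ⌈β⌉`. -/
theorem norm_mul_add_le_conjBound {τ : BetaField β →+* ℂ} (h : τ (gen β) ≠ (β : ℂ)) {y d : ℂ}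
    (hy : ‖y‖ ≤ conjBound β τ) (hd : ‖d‖ ≤ ⌈β⌉₊) : ‖τ (gen β) * y + d‖ ≤ conjBound β τ := by
  have h1 := norm_gen_lt_one β h
  calc ‖τ (gen β) * y + d‖ ≤ ‖τ (gen β)‖ * ‖y‖ + ‖d‖ := by
        rw [← norm_mul]; exact norm_add_le _ _
    _ ≤ ‖τ (gen β)‖ * conjBound β τ + ⌈β⌉₊ := by gcongr
    _ = conjBound β τ := by
        unfold conjBound
        field_simp [(by linarith : (1 : ℝ) - ‖τ (gen β)‖ ≠ 0)]
        ring

/-! ### Finiteness of the orbit of `1`. -/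

theorem finite_of_conj_bounded (C : (BetaField β →+* ℂ) → ℝ) :
    {x : BetaField β | IsIntegral ℤ x ∧ ∀ τ : BetaField β →+* ℂ, ‖τ x‖ ≤ C τ}.Finite := by
  refine (NumberField.Embeddings.finite_of_norm_le (BetaField β) ℂ (∑ τ, |C τ|)).subset ?_
  rintro x ⟨h, h'⟩
  exact ⟨h, fun τ => (h' τ).trans <| (le_abs_self _).trans <|
    Finset.single_le_sum (f := fun τ => |C τ|) (fun _ _ => abs_nonneg _) (Finset.mem_univ τ)⟩

theorem dstar_le_ceil (i : ℕ) : dstar β i ≤ ⌈β⌉₊ := by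
  have h := mul_quasiOrbit β i
  have h1 := quasiOrbit_mem hβ.out.one_lt i
  have h2 := quasiOrbit_mem hβ.out.one_lt (i + 1)
  have h3 : (dstar β i : ℝ) ≤ β := by nlinarith [h1.2, h2.1, hβ.out.one_lt]
  exact_mod_cast h3.trans (Nat.le_ceil β)

/-- The orbit consists of algebraic integers. The inclusion keeps them in `(0,1]`, and the other
embeddings contract by the Pisot property, so all conjugates are bounded. -/
theorem finite_range_quasiOrbit : (Set.range (quasiOrbit β)).Finite := by
  have hint : ∀ i, IsIntegral ℤ (quasiOrbitField β i) := fun i => by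
    induction i with
    | zero => exact isIntegral_one
    | succ i ih =>
      exact ((isIntegral_gen β).mul ih).sub (isIntegral_natCast _)
  have hb : ∀ i, ∀ τ : BetaField β →+* ℂ, ‖τ (quasiOrbitField β i)‖ ≤ max 1 (conjBound β τ) := fun i τ => by
    by_cases h : τ (gen β) = (β : ℂ)
    · rw [apply_eq_of_apply_gen β h, coe_quasiOrbitField]
      have := quasiOrbit_mem hβ.out.one_lt i
      simp only [Complex.norm_real, Real.norm_eq_abs, abs_of_pos this.1]
      exact le_max_of_le_left this.2
    · refine le_max_of_le_right ?_
      induction i with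
      | zero =>
        have h1 := norm_gen_lt_one β h
        have h2 : (1 : ℝ) ≤ ⌈β⌉₊ := hβ.out.one_lt.le.trans (Nat.le_ceil β)
        rw [quasiOrbitField, map_one, norm_one, conjBound, le_div_iff₀ (by linarith)]
        linarith [norm_nonneg (τ (gen β))]
      | succ i ih =>
        rw [quasiOrbitField, map_sub, map_mul, sub_eq_add_neg]
        refine norm_mul_add_le_conjBound h ih ?_
        simpa using dstar_le_ceil (β := β) i
  refine ((finite_of_conj_bounded (β := β) fun τ => max 1 (conjBound β τ)).image
    (Subtype.val)).subset ?_
  rintro _ ⟨i, rfl⟩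
  exact ⟨_, ⟨hint i, hb i⟩, coe_quasiOrbitField i⟩

theorem isIntegral_of_valuation_le_one {x : BetaField β}
    (h : ∀ P : IsDedekindDomain.HeightOneSpectrum (𝓞 (BetaField β)), P.valuation _ x ≤ 1) :
    IsIntegral ℤ x := by
  obtain ⟨y, rfl⟩ :=
    IsDedekindDomain.HeightOneSpectrum.mem_integers_of_valuation_le_one (BetaField β) x h
  exact y.2

theorem valuation_le_one_of_isIntegral {x : BetaField β} (h : IsIntegral ℤ x)
    (P : IsDedekindDomain.HeightOneSpectrum (𝓞 (BetaField β))) : P.valuation _ x ≤ 1 :=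
  P.valuation_le_one (⟨x, h⟩ : 𝓞 (BetaField β))

/-! ### Values of strings -/

theorem isIntegral_value (w : List ℕ) : IsIntegral ℤ (value β w) := by
  induction w using List.reverseRecOn with
  | nil => exact isIntegral_zero
  | append_singleton w ε ih =>
    rw [value_append_singleton]
    exact ((isIntegral_gen β).mul ih).add (isIntegral_natCast _)

theorem norm_value_le {τ : BetaField β →+* ℂ} (h : τ (gen β) ≠ (β : ℂ)) {w : List ℕ}
    (hw : ∀ d ∈ w, d < ⌈β⌉₊) : ‖τ (value β w)‖ ≤ conjBound β τ := by
  induction w using List.reverseRecOn with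
  | nil => simpa using conjBound_nonneg h
  | append_singleton w ε ih =>
    rw [value_append_singleton, map_add, map_mul]
    refine norm_mul_add_le_conjBound h (ih fun d hd => hw d (by simp [hd])) ?_
    simpa using (hw ε (by simp)).le

theorem value_digits {x : ℝ} (hx : x ∈ Set.Ico (0 : ℝ) 1) (k : ℕ) :
    ((value β (digits β x k) : BetaField β) : ℝ) = β ^ k * x - (T β)^[k] x := by
  have h0 : 0 ≤ β := by linarith [hβ.out.one_lt]
  induction k with
  | zero => simp [digits]
  | succ k ih =>
    have := mul_T_iterate h0 (T_iterate_mem_Ico β hx k).1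
    rw [digits_succ, value_append_singleton]
    push_cast
    rw [ih, coe_gen, pow_succ]
    linarith

/-! ### The embedding `φ_β` -/

variable (β) in
/-- `φ_β` as a ring homomorphism. -/
noncomputable def phiHom : BetaField β →+* KBeta β :=
  ((RingHom.pi fun τ : RealConj β => τ.1).prod (RingHom.pi fun τ : ComplexConj β => τ.1)).prod
    (RingHom.pi fun P : PrimesAbove β => algebraMap (BetaField β) (P.1.adicCompletion (BetaField β)))

theorem phiHom_apply (x : BetaField β) : phiHom β x = phi β x := rfl

theorem phi_neg (x : BetaField β) : phi β (-x) = -phi β x := map_neg (phiHom β) x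

theorem valued_phiFin (x : BetaField β) (P : PrimesAbove β) :
    Valued.v (phiFin β x P) = P.1.valuation (BetaField β) x :=
  P.1.valuedAdicCompletion_eq_valuation' x

theorem realConj_gen_ne (τ : RealConj β) :
    Complex.ofRealHom.comp τ.1 (gen β) ≠ (β : ℂ) := fun h => τ.2 <| ringHom_ext_gen β <| by
  simpa [IntermediateField.algebraMap_apply] using h

/-- The Archimedean coordinates contract because `β` is Pisot, the others because `β` lies in each
chosen prime. -/
theorem tendsto_phi_gen_pow :
    Filter.Tendsto (fun k : ℕ => phi β (gen β ^ k)) Filter.atTop (nhds 0) := by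
  refine Filter.Tendsto.prodMk_nhds (Filter.Tendsto.prodMk_nhds ?_ ?_) ?_
  · refine tendsto_pi_nhds.2 fun τ => ?_
    have := norm_gen_lt_one β (realConj_gen_ne τ)
    simp only [map_pow]
    exact tendsto_pow_atTop_nhds_zero_of_norm_lt_one (by simpa using this)
  · refine tendsto_pi_nhds.2 fun τ => ?_
    simp only [map_pow]
    exact tendsto_pow_atTop_nhds_zero_of_norm_lt_one (norm_gen_lt_one β (complexConj_gen_ne τ))
  · refine tendsto_pi_nhds.2 fun P => ?_
    simp only [phiFin, map_pow]
    refine Valued.tendsto_zero_pow_of_v_lt_one ?_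
    have := valued_phiFin (gen β) P
    rw [phiFin] at this
    rw [this]
    exact (P.1.valuation_lt_one_iff_mem (K := BetaField β) (genInt β)).2 P.2

/-- If `-φ_β(z)` lies in the central tile then the conjugates of `z` are bounded, and `z` is
integral at the primes above `β`. -/
theorem bounds_of_neg_phi_mem_tile {z : BetaField β} (hz : -phi β z ∈ tile β) :
    (∀ τ : BetaField β →+* ℂ, τ (gen β) ≠ (β : ℂ) → ‖τ z‖ ≤ conjBound β τ) ∧
      ∀ P : PrimesAbove β, P.1.valuation (BetaField β) z ≤ 1 := by
  have hreal : ∀ τ : RealConj β, ‖τ.1 z‖ ≤ conjBound β (Complex.ofRealHom.comp τ.1) := fun τ => by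
    have : tile β ⊆ {y | ‖y.1.1 τ‖ ≤ conjBound β (Complex.ofRealHom.comp τ.1)} := by
      refine closure_minimal ?_ (isClosed_le (by fun_prop) continuous_const)
      rintro _ ⟨_, ⟨w, hw, rfl⟩, rfl⟩
      have := norm_value_le (realConj_gen_ne τ) hw.1
      rwa [RingHom.comp_apply, Complex.ofRealHom_eq_coe, Complex.norm_real] at this
    simpa [phi, phiInf] using this hz
  have hcomplex : ∀ τ : ComplexConj β, ‖τ.1 z‖ ≤ conjBound β τ.1 := fun τ => by
    have : tile β ⊆ {y | ‖y.1.2 τ‖ ≤ conjBound β τ.1} := by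
      refine closure_minimal ?_ (isClosed_le (by fun_prop) continuous_const)
      rintro _ ⟨_, ⟨w, hw, rfl⟩, rfl⟩
      exact norm_value_le (complexConj_gen_ne τ) hw.1
    simpa [phi, phiInf] using this hz
  refine ⟨fun τ hτ => ?_, fun P => ?_⟩
  · have hconj : ∀ x, (NumberField.ComplexEmbedding.conjugate τ) x = (starRingEnd ℂ) (τ x) :=
      fun x => rfl
    -- `KInf` contains one embedding of each complex pair. The other is reached by conjugation,
    -- which preserves norms; imaginary part `0` means that `τ` is a real embedding.
    rcases lt_trichotomy 0 (τ (gen β)).im with h | h | h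
    · exact hcomplex ⟨τ, h⟩
    · have hr : NumberField.ComplexEmbedding.IsReal τ := by
        rw [NumberField.ComplexEmbedding.isReal_iff]
        exact ringHom_ext_gen β (by rw [hconj]; exact Complex.conj_eq_iff_im.2 h.symm)
      have he : Complex.ofRealHom.comp hr.embedding = τ := by
        ext x; exact hr.coe_embedding_apply x
      have h1 : ‖hr.embedding z‖ ≤ conjBound β (Complex.ofRealHom.comp hr.embedding) :=
        hreal ⟨hr.embedding, fun h2 => hτ <| by
          rw [← he, h2]; simp [IntermediateField.algebraMap_apply]⟩
      rwa [he, ← Complex.norm_real, hr.coe_embedding_apply] at h1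
    · have h1 := hcomplex ⟨NumberField.ComplexEmbedding.conjugate τ, by rw [hconj]; simpa using h⟩
      simpa [hconj, conjBound] using h1
  · have : tile β ⊆ {y | y.2 P ∈ (Valued.v : Valuation (P.1.adicCompletion (BetaField β)) _).integer} := by
      refine closure_minimal ?_ ((Valued.isClosed_integer _).preimage (by fun_prop))
      rintro _ ⟨_, ⟨w, hw, rfl⟩, rfl⟩
      change Valued.v (phiFin β (value β w) P) ≤ 1
      exact (valued_phiFin _ P).trans_le (valuation_le_one_of_isIntegral (isIntegral_value w) _)
    have h1 := this hz
    rw [← phi_neg] at h1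
    have h2 := (valued_phiFin (-z) P).symm.trans_le h1
    rwa [Valuation.map_neg] at h2

theorem subtile_subset_tile (a : ℕ) : subtile β a ⊆ tile β :=
  closure_mono (Set.image_mono (Set.image_mono fun _ h => h.1))

end Field

/-! ### Characterization of pure periodicity by the natural extension -/

section PurePeriodicity

variable {β : ℝ} [hβ : Fact (IsPisot β)]

theorem dstar_zero_pos : 0 < dstar β 0 := by
  have h := mul_quasiOrbit β 0
  have h1 := (quasiOrbit_mem hβ.out.one_lt 1).2
  have h2 := hβ.out.one_lt
  have h3 : (0 : ℝ) < dstar β 0 := by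
    simp only [quasiOrbit] at h h1
    linarith
  exact_mod_cast h3

theorem nil_mem_language : [] ∈ language β 1 :=
  ⟨⟨by simp, fun k => ⟨0, by simp, by simpa using dstar_zero_pos⟩⟩, .nil 1⟩

theorem phi_value_mem_subtile {a : ℕ} {w : List ℕ} (h : w ∈ language β a) :
    phi β (value β w) ∈ subtile β a :=
  subset_closure ⟨_, ⟨w, h, rfl⟩, rfl⟩

theorem exists_edge_of_mem_language {a : ℕ} {w : List ℕ} (h : w ∈ language β a) :
    ∃ b ε, Edge β b ε a ∧ ε < ⌈β⌉₊ ∧ ∃ v ∈ language β b, value β w = gen β * value β v + ε := by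
  rcases List.eq_nil_or_concat' w with rfl | ⟨v, ε, rfl⟩
  · obtain rfl : 1 = a := by
      have := h.2
      cases this
      rfl
    -- The empty string has no last letter. It is its own predecessor through the loop labelled `0`
    -- at node `1`, as `0 = β * 0 + 0`.
    refine ⟨1, 0, ⟨⟨le_rfl, size_pos hβ.out.one_lt finite_range_quasiOrbit⟩,
      .inl ⟨dstar_zero_pos, rfl⟩⟩, Nat.ceil_pos.2 (by linarith [hβ.out.one_lt]),
      [], nil_mem_language, by simp⟩
  · obtain ⟨b, hb, he⟩ := leads_append_singleton_iff.1 h.2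
    exact ⟨b, ε, he, h.1.1 ε (by simp), v, ⟨h.1.of_append, hb⟩, value_append_singleton v ε⟩

/-- The recursion on strings passes to closures because only finitely many edges enter `a`. -/
theorem exists_edge_of_mem_subtile {a : ℕ} {y : KBeta β} (hy : y ∈ subtile β a) :
    ∃ b ε, Edge β b ε a ∧ ε < ⌈β⌉₊ ∧
      phi β (gen β)⁻¹ * (y - phi β (ε : BetaField β)) ∈ subtile β b := by
  let I : Set (ℕ × ℕ) := {i | Edge β i.1 i.2 a ∧ i.2 < ⌈β⌉₊}
  have hI : I.Finite := ((Set.finite_Icc 1 (size β)).prod (Set.finite_Iio ⌈β⌉₊)).subset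
    fun i hi => ⟨hi.1.1, hi.2⟩
  have hsub : subtile β a ⊆ ⋃ i ∈ I,
      {y | phi β (gen β)⁻¹ * (y - phi β (i.2 : BetaField β)) ∈ subtile β i.1} := by
    refine closure_minimal ?_ (hI.isClosed_biUnion fun i _ =>
      (isClosed_closure (s := phi β '' (value β '' language β i.1))).preimage
        (continuous_const.mul (continuous_id.sub continuous_const)))
    rintro _ ⟨_, ⟨w, hw, rfl⟩, rfl⟩
    obtain ⟨b, ε, he, hε, v, hv, hval⟩ := exists_edge_of_mem_language hw
    refine Set.mem_biUnion (x := (b, ε)) ⟨he, hε⟩ ?_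
    have : phi β (gen β)⁻¹ * (phi β (value β w) - phi β (ε : BetaField β)) = phi β (value β v) := by
      rw [hval, ← phiHom_apply, ← phiHom_apply, ← phiHom_apply, ← phiHom_apply, ← map_sub,
        ← map_mul, add_sub_cancel_right, inv_mul_cancel_left₀ (gen_ne_zero β)]
    simp only [Set.mem_ofPred_eq, this]
    exact phi_value_mem_subtile hv
  obtain ⟨i, hi, h⟩ := Set.mem_iUnion₂.1 (hsub hy)
  exact ⟨i.1, i.2, hi.1, hi.2, h⟩

variable (β) in
/-- The `z ∈ [0,1)` in `ℚ(β)` for which `(-φ_β(z), z)` lies in the natural extension domain. -/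
def extensionDomain : Set (BetaField β) :=
  {z | (z : ℝ) ∈ Set.Ico (0 : ℝ) 1 ∧
    ∃ a, (z : ℝ) < quasiOrbit β (a - 1) ∧ -phi β z ∈ subtile β a}

theorem exists_backward_step {z : BetaField β} (hz : z ∈ extensionDomain β) :
    ∃ ε : ℕ, (z + ε) / gen β ∈ extensionDomain β ∧
      T β (((z + ε) / gen β : BetaField β) : ℝ) = (z : ℝ) := by
  obtain ⟨hz1, a, ha, hza⟩ := hz
  obtain ⟨b, ε, he, hε, hb⟩ := exists_edge_of_mem_subtile hza
  have hcoe : (((z + ε) / gen β : BetaField β) : ℝ) = ((z : ℝ) + ε) / β := by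
    push_cast; rw [coe_gen]
  have hβ0 : β ≠ 0 := by linarith [hβ.out.one_lt]
  refine ⟨ε, ⟨?_, b, ?_, ?_⟩, ?_⟩
  · rw [hcoe]; exact (lt_of_edge hβ.out.one_lt finite_range_quasiOrbit he hz1 ha).1
  · rw [hcoe]; exact (lt_of_edge hβ.out.one_lt finite_range_quasiOrbit he hz1 ha).2
  · convert hb using 1
    simp only [← phiHom_apply, ← map_sub, ← map_mul, ← map_neg]
    congr 1
    field_simp [gen_ne_zero β]
    ring
  · rw [hcoe, T, mul_div_cancel₀ _ hβ0, Int.fract_add_natCast, Int.fract_eq_self.2 hz1]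

theorem valuation_gen_eq_one {P : IsDedekindDomain.HeightOneSpectrum (𝓞 (BetaField β))}
    (hP : genInt β ∉ P.asIdeal) : P.valuation (BetaField β) (gen β) = 1 :=
  P.valuation_eq_one_iff_notMem.2 hP

variable (β) in
/-- The elements of the extension domain whose denominators divide `q` away from `β`. -/
def extensionDomainDenom (q : ℤ) : Set (BetaField β) :=
  {z | z ∈ extensionDomain β ∧ ∀ P : IsDedekindDomain.HeightOneSpectrum (𝓞 (BetaField β)),
    genInt β ∉ P.asIdeal → P.valuation (BetaField β) (q * z) ≤ 1}

/-- Multiplication by `q` turns these elements into algebraic integers with bounded conjugates: the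
tile controls the primes above `β` and all embeddings but the inclusion. -/
theorem finite_extensionDomainDenom {q : ℤ} (hq : q ≠ 0) :
    (extensionDomainDenom β q).Finite := by
  have hq' : (q : BetaField β) ≠ 0 := by exact_mod_cast hq
  refine Set.Finite.subset (((finite_of_conj_bounded (β := β)
    fun τ => ‖(q : ℂ)‖ * max 1 (conjBound β τ))).preimage (f := fun z => (q : BetaField β) * z)
      (mul_right_injective₀ hq').injOn) ?_
  rintro z ⟨⟨hz, a, -, ha⟩, hP⟩
  obtain ⟨h1, h2⟩ := bounds_of_neg_phi_mem_tile (subtile_subset_tile a ha)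
  refine ⟨isIntegral_of_valuation_le_one fun P => ?_, fun τ => ?_⟩
  · by_cases hP' : genInt β ∈ P.asIdeal
    · rw [map_mul]
      exact mul_le_one' (valuation_le_one_of_isIntegral (isIntegral_algebraMap (R := ℤ) (x := q)) P)
        (h2 ⟨P, hP'⟩)
    · exact hP P hP'
  · rw [map_mul, norm_mul, map_intCast]
    gcongr
    by_cases h : τ (gen β) = (β : ℂ)
    · rw [apply_eq_of_apply_gen β h, Complex.norm_real, Real.norm_eq_abs, abs_of_nonneg hz.1]
      exact le_max_of_le_left hz.2.le
    · exact le_max_of_le_right (h1 τ h)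

/-- Backward steps never leave a finite set, since `β` is a unit at the primes not containing it.
Choosing one preimage for each point gives an injective self-map, all of whose points are periodic;
`T` runs along its cycles in reverse. -/
theorem exists_iterate_eq_of_mem_extensionDomain {z : BetaField β}
    (hz : z ∈ extensionDomain β) : ∃ l, 0 < l ∧ (T β)^[l] (z : ℝ) = (z : ℝ) := by
  obtain ⟨q, hq, hqz⟩ : ∃ q : ℤ, q ≠ 0 ∧ IsIntegral ℤ ((q : BetaField β) * z) := by
    obtain ⟨q, hq, h⟩ := (IsAlgebraic.exists_integral_multiple
      (R := ℤ) ((IsFractionRing.isAlgebraic_iff ℤ ℚ (BetaField β)).2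
        (Algebra.IsAlgebraic.isAlgebraic z)))
    exact ⟨q, hq, by simpa using h⟩
  let S := extensionDomainDenom β q
  have : Finite S := finite_extensionDomainDenom hq
  have hstep : ∀ y : S, ∃ y' : S, T β ((y' : BetaField β) : ℝ) = ((y : BetaField β) : ℝ) := by
    rintro ⟨y, hy, hP⟩
    obtain ⟨ε, h1, h2⟩ := exists_backward_step hy
    refine ⟨⟨_, h1, fun P hPβ => ?_⟩, h2⟩
    rw [mul_div_assoc', map_div₀, valuation_gen_eq_one hPβ, div_one, mul_add]
    refine Valuation.map_add_le _ (hP P hPβ) (valuation_le_one_of_isIntegral ?_ P)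
    exact (isIntegral_algebraMap (R := ℤ) (x := q)).mul (isIntegral_natCast _)
  choose f hf using hstep
  have hinj : Function.Injective f := fun y y' h => by
    have := (hf y).symm.trans ((congrArg (fun s : S => T β ((s : BetaField β) : ℝ)) h).trans (hf y'))
    exact Subtype.ext (Subtype.ext this)
  have hz' : z ∈ S := ⟨hz, fun P _ => valuation_le_one_of_isIntegral hqz P⟩
  obtain ⟨l, hl, hper⟩ := hinj.mem_periodicPts ⟨z, hz'⟩
  have hit : ∀ (k : ℕ) (y : S), (T β)^[k] ((f^[k] y : BetaField β) : ℝ) = ((y : BetaField β) : ℝ) := by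
    intro k
    induction k with
    | zero => exact fun _ => rfl
    | succ k ih =>
      intro y
      rw [Function.iterate_succ_apply', Function.iterate_succ_apply, ih, hf]
  refine ⟨l, hl, ?_⟩
  have := hit l ⟨z, hz'⟩
  rwa [hper] at this

theorem exists_subtile_of_iterate_eq {z : BetaField β} (hz : (z : ℝ) ∈ Set.Ico (0 : ℝ) 1) {l : ℕ}
    (hl : 0 < l) (h : (T β)^[l] (z : ℝ) = (z : ℝ)) :
    ∃ a ∈ Set.Icc 1 (size β), (z : ℝ) < quasiOrbit β (a - 1) ∧ -phi β z ∈ subtile β a := by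
  let I : Set ℕ := {a | a ∈ Set.Icc 1 (size β) ∧ (z : ℝ) < quasiOrbit β (a - 1)}
  have hI : I.Finite := (Set.finite_Icc 1 (size β)).subset fun a ha => ha.1
  have hclosed : IsClosed (⋃ a ∈ I, subtile β a) :=
    hI.isClosed_biUnion fun a _ => isClosed_closure
  -- Reading `j` full periods gives a string of value `β^{lj} z - z`, whose image tends to
  -- `-φ_β(z)`.
  have hmem : ∀ j : ℕ, phi β (gen β ^ (l * j)) * phi β z - phi β z ∈ ⋃ a ∈ I, subtile β a := by
    intro j
    obtain ⟨a, ha, hL, hlt⟩ :=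
      exists_leads_digits hβ.out.one_lt finite_range_quasiOrbit hz (l * j)
    rw [T_iterate_mul h] at hlt
    refine Set.mem_biUnion (x := a) ⟨ha, hlt⟩ ?_
    have hval : value β (digits β z (l * j)) = gen β ^ (l * j) * z - z := by
      apply Subtype.ext
      have := value_digits (β := β) hz (l * j)
      rw [T_iterate_mul h] at this
      rw [this]
      push_cast
      rw [coe_gen]
    have := phi_value_mem_subtile (β := β) (w := digits β z (l * j)) (a := a)
      ⟨admissible_digits hβ.out.one_lt hz _, hL⟩
    rw [hval] at this
    simpa only [← phiHom_apply, map_sub, map_mul] using this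
  have hlim : Filter.Tendsto (fun j : ℕ => phi β (gen β ^ (l * j)) * phi β z - phi β z)
      Filter.atTop (nhds (0 * phi β z - phi β z)) :=
    ((tendsto_phi_gen_pow.comp (Filter.tendsto_id.const_mul_atTop' hl)).mul_const _).sub_const _
  have := hclosed.mem_of_tendsto hlim (.of_forall hmem)
  rw [zero_mul, zero_sub] at this
  obtain ⟨a, ha, h⟩ := Set.mem_iUnion₂.1 this
  exact ⟨a, ha.1, ha.2, h⟩

theorem mem_purelyPeriodic_iff_exists_subtile {z : BetaField β}
    (hz : (z : ℝ) ∈ Set.Ico (0 : ℝ) 1) :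
    (z : ℝ) ∈ purelyPeriodic β ↔
      ∃ a ∈ Set.Icc 1 (size β), (z : ℝ) < quasiOrbit β (a - 1) ∧ phi β z ∈ -subtile β a := by
  rw [mem_purelyPeriodic_iff hβ.out.one_lt hz]
  constructor
  · rintro ⟨l, hl, h⟩
    exact exists_subtile_of_iterate_eq hz hl h
  · rintro ⟨a, -, h⟩
    exact exists_iterate_eq_of_mem_extensionDomain ⟨hz, a, h⟩

end PurePeriodicity

/-! ### Density of `ℤ_(N(β))` in the stripes -/

theorem continuous_diag {β : ℝ} : Continuous (diag β) := by
  unfold diag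
  fun_prop

section Density

variable {β : ℝ} [hβ : Fact (IsPisot β)]

theorem normBeta_ne_zero : normBeta β ≠ 0 :=
  Algebra.norm_ne_zero_iff.2 fun h => gen_ne_zero β (congrArg Subtype.val h)

theorem natAbs_normBeta_mem (P : PrimesAbove β) :
    (((normBeta β).natAbs : ℕ) : 𝓞 (BetaField β)) ∈ P.1.asIdeal := by
  have h := Ideal.absNorm_mem (Ideal.span {genInt β})
  rw [Ideal.absNorm_span_singleton] at h
  exact (Ideal.span_singleton_le_iff_mem _).2 P.2 h

theorem add_mem_ZN {x y : ℚ} (hx : x ∈ ZN β) (hy : y ∈ ZN β) : x + y ∈ ZN β := by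
  have hx' : x.den.Coprime (normBeta β).natAbs := hx
  have hy' : y.den.Coprime (normBeta β).natAbs := hy
  exact Nat.Coprime.coprime_dvd_left (Rat.add_den_dvd x y) (hx'.mul_left hy')

theorem intCast_div_mem_ZN (m : ℤ) {q : ℕ} (hq : q.Coprime (normBeta β).natAbs) :
    (m / q : ℚ) ∈ ZN β := by
  have h : ((m / q : ℚ).den : ℤ) ∣ q := by
    have := Rat.den_dvd m q
    rwa [Rat.divInt_eq_div, Int.cast_natCast] at this
  exact Nat.Coprime.coprime_dvd_left (Int.natCast_dvd_natCast.1 h) hq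

/-- The norm of `β` lies in `P`, so by Bézout an integer prime to it does not. -/
theorem valuation_natCast_eq_one (P : PrimesAbove β) {q : ℕ}
    (hq : q.Coprime (normBeta β).natAbs) : P.1.valuation (BetaField β) (q : BetaField β) = 1 := by
  have h : (q : 𝓞 (BetaField β)) ∉ P.1.asIdeal := fun h => by
    have h1 := Ideal.add_mem _
      (Ideal.mul_mem_right (Int.cast (Nat.gcdA q (normBeta β).natAbs)) _ h)
      (Ideal.mul_mem_right (Int.cast (Nat.gcdB q (normBeta β).natAbs)) _ (natAbs_normBeta_mem P))
    have h2 := Nat.gcd_eq_gcd_ab q (normBeta β).natAbs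
    rw [hq.gcd_eq_one] at h2
    have h3 : (1 : 𝓞 (BetaField β)) ∈ P.1.asIdeal := by
      have h4 := congrArg (Int.cast (R := 𝓞 (BetaField β))) h2
      simp only [Int.cast_add, Int.cast_mul, Int.cast_natCast, Nat.cast_one, Int.cast_one] at h4
      rwa [h4]
    exact P.1.isPrime.ne_top ((Ideal.eq_top_iff_one _).2 h3)
  simpa using P.1.valuation_eq_one_iff_notMem (K := BetaField β).2 h

/-- A rational with denominator prime to `N(β)` can be moved close to any real number by adding a
multiple of a high power of `N(β)`. -/
theorem exists_ZN_near (r : ℝ) {y : ℚ} (hy : y ∈ ZN β) (M : ℕ) :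
    ∃ x ∈ ZN β, |(x : ℝ) - r| ≤ (1 / 2) ^ M ∧ ∀ P : PrimesAbove β,
      P.1.valuation (BetaField β) ((x : BetaField β) - y) ≤
        P.1.valuation (BetaField β) ((normBeta β).natAbs : BetaField β) ^ M := by
  set N := (normBeta β).natAbs with hN
  have hN0 : 0 < N := Int.natAbs_pos.2 normBeta_ne_zero
  -- `Q` is prime to `N`, and `2N ≤ (N + 1)^2` gives `N^M / Q ≤ 2^{-M}`. This is the mesh of the
  -- multiples of `N^M / Q`, and `m` selects the one just below `r - y`.
  set Q : ℕ := (N + 1) ^ (2 * M) with hQ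
  have hQN : Q.Coprime N := Nat.Coprime.pow_left _ (by simp)
  have hQ0 : (0 : ℝ) < Q := by rw [hQ]; positivity
  have hN0' : (0 : ℝ) < N := by exact_mod_cast hN0
  set m : ℤ := ⌊(r - y) * Q / N ^ M⌋ with hm
  refine ⟨y + ((N ^ M * m : ℤ) / Q : ℚ), add_mem_ZN hy (intCast_div_mem_ZN _ hQN), ?_, fun P => ?_⟩
  · have h1 := Int.floor_le ((r - y) * Q / N ^ M)
    have h2 := Int.lt_floor_add_one ((r - y) * Q / N ^ M)
    rw [← hm] at h1 h2
    rw [le_div_iff₀ (by positivity)] at h1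
    rw [div_lt_iff₀ (by positivity)] at h2
    have h3 : (N : ℝ) ^ M / Q ≤ (1 / 2) ^ M := by
      rw [hQ, pow_mul, Nat.cast_pow, ← div_pow]
      refine pow_le_pow_left₀ (by positivity) ?_ _
      rw [div_le_div_iff₀ (by positivity) (by norm_num)]
      push_cast
      nlinarith
    refine le_trans ?_ h3
    have h4 : ((y + ((N ^ M * m : ℤ) / Q : ℚ) : ℚ) : ℝ) - r = (m * N ^ M - (r - y) * Q) / Q := by
      push_cast
      field_simp
      ring
    rw [h4, abs_div, abs_of_pos hQ0]
    gcongr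
    rw [abs_le]
    constructor <;> linarith
  · have h : (((y + ((N ^ M * m : ℤ) / Q : ℚ) : ℚ) : BetaField β)) - y =
        (N : BetaField β) ^ M * m / Q := by
      push_cast; ring
    rw [h, map_div₀, valuation_natCast_eq_one P hQN, div_one, map_mul, map_pow]
    exact mul_le_of_le_one_right' (valuation_le_one_of_isIntegral
      (isIntegral_algebraMap (R := ℤ) (x := m)) P.1)

theorem tendsto_zero_of_valued_le_pow {P : PrimesAbove β}
    {u : ℕ → P.1.adicCompletion (BetaField β)} {c : P.1.adicCompletion (BetaField β)}
    (hc : Valued.v c < 1) (hu : ∀ M, Valued.v (u M) ≤ Valued.v c ^ M) :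
    Filter.Tendsto u Filter.atTop (nhds 0) := by
  have h := Valued.tendsto_zero_pow_of_v_lt_one hc
  rw [(Valued.hasBasis_nhds_zero _ _).tendsto_right_iff] at h ⊢
  intro γ hγ
  filter_upwards [h γ hγ] with M hM
  refine lt_of_le_of_lt ?_ hM
  rw [Valuation.restrict_le_iff, map_pow]
  exact hu M

theorem phi_ratCast (x : ℚ) : phi β (x : BetaField β) = (diag β x, phiFin β x) := by
  simp [phi, phiInf, diag]

/-- Approximating a real and a non-Archimedean coordinate simultaneously by one rational shows that
the given points are dense in the stripe. -/
theorem stripe_subset_of_forall_ZN {C : Set (KBeta β)} (hC : IsClosed C) {s t : ℝ} (hst : s < t)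
    (h : ∀ x ∈ ZN β, s < (x : ℝ) → (x : ℝ) < t → phi β (x : BetaField β) ∈ C) :
    stripe β s t ⊆ C := by
  have key : ∀ r ∈ Set.Ioo s t, ∀ y ∈ ZN β, (diag β r, phiFin β (y : BetaField β)) ∈ C := by
    intro r hr y hy
    choose x hx hxr hxP using exists_ZN_near r hy
    have hlim : Filter.Tendsto (fun M => (x M : ℝ)) Filter.atTop (nhds r) := by
      rw [tendsto_iff_dist_tendsto_zero]
      exact squeeze_zero (fun _ => dist_nonneg) hxr
        (tendsto_pow_atTop_nhds_zero_of_lt_one (by norm_num) (by norm_num))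
    have hlim' : Filter.Tendsto (fun M => phiFin β (x M : BetaField β)) Filter.atTop
        (nhds (phiFin β (y : BetaField β))) := by
      refine tendsto_pi_nhds.2 fun P => tendsto_sub_nhds_zero_iff.1 ?_
      refine tendsto_zero_of_valued_le_pow
        (c := phiFin β ((normBeta β).natAbs : BetaField β) P) ?_ fun M => ?_
      · rw [valued_phiFin]
        simpa using (P.1.valuation_lt_one_iff_mem (K := BetaField β) _).2 (natAbs_normBeta_mem P)
      · have := hxP M P
        rw [← valued_phiFin, ← valued_phiFin] at this
        refine le_of_eq_of_le ?_ this
        simp [phiFin]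
    have hev : ∀ᶠ M in Filter.atTop, phi β (x M : BetaField β) ∈ C := by
      filter_upwards [hlim.eventually (Ioo_mem_nhds hr.1 hr.2)] with M hM
      exact h _ (hx M) hM.1 hM.2
    refine hC.mem_of_tendsto ?_ hev
    simp only [phi_ratCast]
    exact ((continuous_diag.tendsto r).comp hlim).prodMk_nhds hlim'
  have hsub : (diag β '' Set.Ioo s t) ×ˢ ((fun x : ℚ => phiFin β (x : BetaField β)) '' ZN β) ⊆ C := by
    rintro ⟨_, _⟩ ⟨⟨r, hr, rfl⟩, y, hy, rfl⟩
    exact key r hr y hy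
  refine Set.Subset.trans ?_ (closure_minimal hsub hC)
  rw [closure_prod_eq]
  refine Set.prod_mono ?_ subset_rfl
  rw [← closure_Ioo hst.ne]
  exact image_closure_subset_closure_image continuous_diag

theorem phi_mem_stripe {x : ℚ} (hx : x ∈ ZN β) {s t : ℝ} (h : (x : ℝ) ∈ Set.Icc s t) :
    phi β (x : BetaField β) ∈ stripe β s t := by
  rw [phi_ratCast]
  exact ⟨⟨x, h, rfl⟩, subset_closure ⟨x, hx, rfl⟩⟩

theorem stripe_mono {s t t' : ℝ} (h : t ≤ t') : stripe β s t ⊆ stripe β s t' :=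
  Set.prod_mono (Set.image_mono (Set.Icc_subset_Icc_right h)) subset_rfl

end Density

/-! ### The function `γ` -/

section Gamma

variable {β : ℝ} [hβ : Fact (IsPisot β)]

theorem gamma_nonneg : 0 ≤ gamma β := Real.sSup_nonneg fun _ hv => hv.1.1

theorem mem_purelyPeriodic_of_lt_gamma {x : ℚ} (hx : 0 < x) (h : (x : ℝ) < gamma β)
    (hxN : x ∈ ZN β) : (x : ℝ) ∈ purelyPeriodic β := by
  rw [gamma] at h
  obtain ⟨v, hv, hxv⟩ := exists_lt_of_lt_csSup (by
    -- The value `v = 0` qualifies vacuously.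
    exact ⟨0, by simp, fun y hy hy' => absurd hy (not_lt.2 (by exact_mod_cast hy'))⟩) h
  exact hv.2 x hx hxv.le hxN

theorem le_gamma {t : ℝ} (ht : t ≤ 1)
    (h : ∀ x : ℚ, 0 < x → (x : ℝ) < t → x ∈ ZN β → (x : ℝ) ∈ purelyPeriodic β) :
    t ≤ gamma β := by
  refine le_of_forall_lt fun v hv => ?_
  rcases lt_or_ge v 0 with h0 | h0
  · exact h0.trans_le gamma_nonneg
  · obtain ⟨u, hvu, hut⟩ := exists_between hv
    refine hvu.trans_le (le_csSup ⟨1, fun _ h => h.1.2⟩ ⟨⟨by linarith, by linarith⟩, ?_⟩)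
    exact fun x hx hxu hxN => h x hx (hxu.trans_lt hut) hxN

theorem gamma_eq_zero_of_not_stripe_subset
    (h : ∀ η : ℝ, 0 < η → ¬ stripe β 0 η ⊆ -tile β) : gamma β = 0 := by
  refine le_antisymm (not_lt.1 fun hpos => ?_) gamma_nonneg
  refine h _ hpos (stripe_subset_of_forall_ZN isClosed_closure.neg hpos fun x hx h0 hxγ => ?_)
  have hx0 : 0 < x := by exact_mod_cast h0
  have hpp := mem_purelyPeriodic_of_lt_gamma hx0 hxγ hx
  have hco : (((x : BetaField β)) : ℝ) = x := by push_cast; rfl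
  obtain ⟨a, -, -, ha⟩ := (mem_purelyPeriodic_iff_exists_subtile (z := (x : BetaField β))
    (by rw [hco]; exact hpp.1)).1 (by rwa [hco])
  exact subtile_subset_tile a ha

variable {a : ℕ → ℕ} (ha : IsOrbitOrdering β a)

include ha

theorem level_eq_quasiOrbit {k : ℕ} (hk : k ∈ Set.Icc 1 (size β)) :
    level β a k = quasiOrbit β (a k - 1) := by
  have h1 := (ha.bijOn.mapsTo hk)
  have h2 := h1.1
  have h3 := h1.2
  rw [level, if_neg (by have := hk.1; omega),
    quasiOrbit_eq_T_iterate hβ.out.one_lt (by omega)]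

theorem level_lt_level {i j : ℕ} (hij : i < j) (hj : j ≤ size β) : level β a i < level β a j := by
  have hj' : j ∈ Set.Icc 1 (size β) := ⟨by omega, hj⟩
  rcases Nat.eq_zero_or_pos i with rfl | hi
  · rw [level_eq_quasiOrbit ha hj', level, if_pos rfl]
    exact (quasiOrbit_mem hβ.out.one_lt _).1
  · have := ha.strictMonoOn ⟨hi, by omega⟩ hj' hij
    rwa [level, level, if_neg hi.ne', if_neg (by omega)]

/-- No level lies strictly between the two bounds on `x`, so `x < level β a j` holds exactly for `j
≥ k`. -/
theorem mem_purelyPeriodic_iff_mem_negSubtiles {k : ℕ} (hk : k ∈ Set.Icc 1 (size β)) {x : ℚ}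
    (hx : 0 ≤ x) (h : level β a (k - 1) ≤ x) (h' : (x : ℝ) < level β a k) :
    (x : ℝ) ∈ purelyPeriodic β ↔ phi β (x : BetaField β) ∈ negSubtiles β a k := by
  have hco : (((x : BetaField β)) : ℝ) = x := by push_cast; rfl
  have hle1 : level β a k ≤ 1 := by
    rw [level_eq_quasiOrbit ha hk]; exact (quasiOrbit_mem hβ.out.one_lt _).2
  have := mem_purelyPeriodic_iff_exists_subtile (z := (x : BetaField β))
    (by rw [hco]; exact ⟨by exact_mod_cast hx, h'.trans_le hle1⟩)
  rw [hco] at this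
  rw [this, negSubtiles]
  simp only [Set.mem_iUnion₂]
  constructor
  · rintro ⟨b, hb, hlt, hmem⟩
    obtain ⟨j, hj, rfl⟩ := ha.bijOn.surjOn hb
    refine ⟨j, ⟨?_, hj.2⟩, hmem⟩
    rw [← level_eq_quasiOrbit ha hj] at hlt
    by_contra hjk
    have hle : level β a j ≤ level β a (k - 1) := by
      rcases (by omega : j ≤ k - 1).eq_or_lt with h1 | h1
      · rw [h1]
      · exact (level_lt_level ha h1 (by have := hk.2; omega)).le
    linarith
  · rintro ⟨j, hj, hmem⟩
    have hj' : j ∈ Set.Icc 1 (size β) := ⟨hk.1.trans hj.1, hj.2⟩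
    refine ⟨a j, ha.bijOn.mapsTo hj', ?_, hmem⟩
    rw [← level_eq_quasiOrbit ha hj']
    rcases hj.1.eq_or_lt with rfl | h1
    · exact h'
    · exact h'.trans (level_lt_level ha h1 hj.2)

omit ha in
theorem isClosed_negSubtiles (a : ℕ → ℕ) (k : ℕ) : IsClosed (negSubtiles β a k) :=
  (Set.finite_Icc k (size β)).isClosed_biUnion fun _ _ => isClosed_closure.neg

theorem level_nonneg {k : ℕ} (hk : k ≤ size β) : 0 ≤ level β a k := by
  rcases Nat.eq_zero_or_pos k with rfl | h
  · simp [level]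
  · rw [level_eq_quasiOrbit ha ⟨h, hk⟩]; exact (quasiOrbit_mem hβ.out.one_lt _).1.le

/-- The stripe between the previous level and a lower bound `t` of `γ` lies in the subtiles. -/
theorem stripe_subset_negSubtiles {k : ℕ} (hk : k ∈ Set.Icc 1 (size β)) {t : ℝ}
    (h : level β a (k - 1) < t) (h' : t ≤ level β a k) (ht : t ≤ gamma β) :
    stripe β (level β a (k - 1)) t ⊆ negSubtiles β a k := by
  refine stripe_subset_of_forall_ZN (isClosed_negSubtiles a k) h fun x hx h1 h2 => ?_
  have h0 : (0 : ℝ) < x := (level_nonneg ha (by have := hk.2; omega)).trans_lt h1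
  have hx0 : 0 < x := by exact_mod_cast h0
  exact (mem_purelyPeriodic_iff_mem_negSubtiles ha hk hx0.le h1.le (h2.trans_le h')).1
    (mem_purelyPeriodic_of_lt_gamma hx0 (h2.trans_le ht) hx)

/-- The stripe handles `x` from the previous level on; smaller `x` lie strictly below `γ`. -/
theorem le_gamma_of_stripe_subset {k : ℕ} (hk : k ∈ Set.Icc 1 (size β)) {t : ℝ}
    (h : level β a (k - 1) ≤ gamma β) (h' : t ≤ level β a k)
    (ht : stripe β (level β a (k - 1)) t ⊆ negSubtiles β a k) : t ≤ gamma β := by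
  have hle1 : level β a k ≤ 1 := by
    rw [level_eq_quasiOrbit ha hk]; exact (quasiOrbit_mem hβ.out.one_lt _).2
  refine le_gamma (h'.trans hle1) fun x hx0 hxt hx => ?_
  rcases lt_or_ge (x : ℝ) (level β a (k - 1)) with h1 | h1
  · exact mem_purelyPeriodic_of_lt_gamma hx0 (h1.trans_le h) hx
  · exact (mem_purelyPeriodic_iff_mem_negSubtiles ha hk hx0.le h1 (hxt.trans_le h')).2
      (ht (phi_mem_stripe hx ⟨h1, hxt.le⟩))

theorem level_le_gamma_iff {k : ℕ} (hk : k ∈ Set.Icc 1 (size β)) :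
    level β a k ≤ gamma β ↔ level β a (k - 1) ≤ gamma β ∧
      stripe β (level β a (k - 1)) (level β a k) ⊆ negSubtiles β a k := by
  have hlt : level β a (k - 1) < level β a k :=
    level_lt_level ha (by have := hk.1; omega) hk.2
  exact ⟨fun h => ⟨hlt.le.trans h, stripe_subset_negSubtiles ha hk hlt le_rfl h⟩,
    fun h => le_gamma_of_stripe_subset ha hk h.1 le_rfl h.2⟩

theorem isGreatest_gamma {k : ℕ} (hk : k ∈ Set.Icc 1 (size β))
    (h : level β a (k - 1) < gamma β) (h' : gamma β ≤ level β a k) :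
    IsGreatest {η : ℝ | level β a (k - 1) ≤ η ∧ η ≤ level β a k ∧
      stripe β (level β a (k - 1)) η ⊆ negSubtiles β a k} (gamma β) :=
  ⟨⟨h.le, h', stripe_subset_negSubtiles ha hk h h' le_rfl⟩,
    fun _ hη => le_gamma_of_stripe_subset ha hk h.le hη.2.1 hη.2.2⟩

theorem isGreatest_gamma_of_lt {k : ℕ} (hk : k ∈ Set.Icc 1 (size β))
    (h : level β a (k - 1) < gamma β) (h' : gamma β < level β a k) :
    IsGreatest {η : ℝ | level β a (k - 1) ≤ η ∧
      stripe β (level β a (k - 1)) η ⊆ negSubtiles β a k} (gamma β) := by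
  refine ⟨⟨h.le, stripe_subset_negSubtiles ha hk h h'.le le_rfl⟩, fun η hη => ?_⟩
  rcases le_or_gt η (level β a k) with h1 | h1
  · exact le_gamma_of_stripe_subset ha hk h.le h1 hη.2
  -- An `η` beyond the level would make the whole stripe up to that level covered, forcing `γ` to
  -- reach it.
  · exact absurd (le_gamma_of_stripe_subset ha hk h.le le_rfl ((stripe_mono h1.le).trans hη.2))
      h'.not_ge

end Gamma

end PisotBeta

theorem mainTheorem10 (β : ℝ) [Fact (PisotBeta.IsPisot β)] :
    (∃ a : ℕ → ℕ, PisotBeta.IsOrbitOrdering β a) ∧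
    (∀ a : ℕ → ℕ, PisotBeta.IsOrbitOrdering β a →
      ∀ k : ℕ, 1 ≤ k → k ≤ PisotBeta.size β →
        (PisotBeta.level β a k ≤ PisotBeta.gamma β ↔
          PisotBeta.level β a (k - 1) ≤ PisotBeta.gamma β ∧
          PisotBeta.stripe β (PisotBeta.level β a (k - 1)) (PisotBeta.level β a k) ⊆
            PisotBeta.negSubtiles β a k) ∧
        (PisotBeta.level β a (k - 1) < PisotBeta.gamma β →
          PisotBeta.gamma β ≤ PisotBeta.level β a k →
          IsLUB {η : ℝ | PisotBeta.level β a (k - 1) ≤ η ∧ η ≤ PisotBeta.level β a k ∧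
            PisotBeta.stripe β (PisotBeta.level β a (k - 1)) η ⊆
              PisotBeta.negSubtiles β a k} (PisotBeta.gamma β)) ∧
        (PisotBeta.level β a (k - 1) < PisotBeta.gamma β →
          PisotBeta.gamma β < PisotBeta.level β a k →
          IsLUB {η : ℝ | PisotBeta.level β a (k - 1) ≤ η ∧
            PisotBeta.stripe β (PisotBeta.level β a (k - 1)) η ⊆
              PisotBeta.negSubtiles β a k} (PisotBeta.gamma β))) ∧
    ((∀ η : ℝ, 0 < η → ¬ PisotBeta.stripe β 0 η ⊆ -PisotBeta.tile β) →
      PisotBeta.gamma β = 0) := by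
  have hβ := (Fact.out : PisotBeta.IsPisot β).one_lt
  refine ⟨PisotBeta.exists_isOrbitOrdering hβ PisotBeta.finite_range_quasiOrbit,
    fun a ha k hk hk' => ⟨PisotBeta.level_le_gamma_iff ha ⟨hk, hk'⟩,
      fun h h' => (PisotBeta.isGreatest_gamma ha ⟨hk, hk'⟩ h h').isLUB,
      fun h h' => (PisotBeta.isGreatest_gamma_of_lt ha ⟨hk, hk'⟩ h h').isLUB⟩,
    PisotBeta.gamma_eq_zero_of_not_stripe_subset⟩
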